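/- **Definitions.** Let $B_l$ be Artin's braid group on $l$ strands; $\beta\beta'$ is $\beta'$ placed on top of $\beta$. A *mixed braid* of type $(m,n)$ is an element of $B_{m+n}$ with $m$ strands colored red (*poles*) and $n$ strands colored blue (*strands*), such that forgetting the blue strands leaves the trivial braid in $B_m$. Its bottom and top are words $o,o'$ in two letters $\mathrm p$ (pole) and $\mathrm s$ (strand). A *mixed permutation* from $o$ to $o'$ is a color-preserving permutation of the letters which becomes trivial when the blue letters are forgotten; every mixed braid $\beta$ has an underlying mixed permutation $\pi(\beta)$. The category $\mathbf{MB}$ has the words as objects, and a morphism $o\to o'$ is a pair $(\sum_j c_j\beta_j,\sigma)$ of a mixed permutation $\sigma$ from $o$ to $o'$ and a $\mathbb Q$-linear combination of mixed braids from $o$ to $o'$ with $\pi(\beta_j)=\sigma$; there are none unless $o,o'$ have the same numbers of poles and of strands. Composition is bilinear and is induced by the product of braids and of permutations. The category $\mathbf{PaMB}$ of parenthesized mixed braids has as objects the parenthesized words $O$ in $\mathrm p,\mathrm s$ (including the empty word). If $o$ is the underlying word of $O$, and $\overline O$ is the parenthesized word in $\mathrm p$ obtained by deleting the letters $\mathrm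 s$, then $\mathbf{PaMB}(O,O')=\mathbf{MB}(o,o')$ if $\overline O=\overline{O'}$, and $\mathbf{PaMB}(O,O')=\emptyset$ otherwise. A morphism given by a single mixed braid $\beta$ (that is, $(\beta,\pi(\beta))$) is called a *parenthesized mixed braid*. The *operadic operations* on $\mathbf{PaMB}$ are the following, extended linearly: adding a straight pole or a straight strand on the left or on the right, outermost in the parenthesization; doubling the $i$-th (counted at the bottom) pole or strand, where the two copies keep the color and form a pair $(\cdot\,\cdot)$ in the parenthesizations of both ends; changing a pole to a strand. The *basic morphisms* are the two crossings $\sigma_{\mathrm{ps}}^{+},\sigma_{\mathrm{ps}}^{-}\colon \mathrm{ps}\to\mathrm{sp}$ (positive and negative: the pole passes over, respectively under, the strand), and the three morphisms with trivial underlying braid $$\alpha_{\mathrm{pps}}\colon(\mathrm{pp})\mathrm s\to\mathrm p(\mathrm{ps}),\qquad \alpha_{\mathrm{psp}}\colon(\mathrm{ps})\mathrm p\to\mathrm p(\mathrm{sp}),\qquad \alpha_{\mathrm{spp}}\colon(\mathrm{sp})\mathrm p\to\mathrm s(\mathrm{pp}).$$ **Proposition 4.1.** The $\mathbb Q$-linear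 category $\mathbf{PaMB}$ is generated by the basic morphisms, their inverses, and the images of these under repeated applications of the operadic operations. That is, if $\mathcal S$ is the smallest class of morphisms which contains the basic morphisms and their inverses and is closed under the operadic operations, then 1. every parenthesized mixed braid is a composition of finitely many (possibly zero) elements of $\mathcal S$; 2. for every morphism $(x,\sigma)\colon O\to O'$ of $\mathbf{PaMB}$, the element $x$ is a $\mathbb Q$-linear combination of the first entries of morphisms $O\to O'$ that have second entry $\sigma$ and are compositions of elements of $\mathcal S$. -/

import Mathlib

open CategoryTheory

namespace MixedBraids

/-- The two kinds of strands of a mixed braid: poles (red) and strands (blue). -/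
inductive Color where
  | pole
  | strand
  deriving DecidableEq

/-- Artin's relators for generators `σ` placed at the positions `pos i`:
`σᵢ σⱼ σᵢ = σⱼ σᵢ σⱼ` for adjacent positions, `σᵢ σⱼ = σⱼ σᵢ` for positions at distance at least 2. -/
def braidRels {ι : Type} (pos : ι → ℕ) : Set (FreeGroup ι) :=
  {r | ∃ i j, pos j = pos i + 1 ∧
      r = FreeGroup.of i * FreeGroup.of j * FreeGroup.of i *
        (FreeGroup.of j * FreeGroup.of i * FreeGroup.of j)⁻¹} ∪
  {r | ∃ i j, pos i + 2 ≤ pos j ∧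
      r = FreeGroup.of i * FreeGroup.of j * (FreeGroup.of j * FreeGroup.of i)⁻¹}

/-- Artin's braid group on `l` strands, by Artin's presentation. -/
abbrev ArtinBraidGroup (l : ℕ) : Type :=
  PresentedGroup (braidRels (Fin.val : Fin (l - 1) → ℕ))

/-- The infinite braid group `B_∞ = ⋃ B_l`, with generators `σ₀, σ₁, …`. All the groups `B_l` are
treated as its subgroups `braidSubgroup l`; see `artinEquiv` for `ArtinBraidGroup l ≃* braidSubgroup l`. -/
abbrev BraidInf : Type := PresentedGroup (braidRels (id : ℕ → ℕ))

/-- The generator `σ_k`: the strand at position `k` passes over the strand at position `k + 1`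
(positions are counted from `0`, from the left). In a product `β * γ` the braid `γ` is on top of `β`. -/
def gen (k : ℕ) : BraidInf := PresentedGroup.of k

theorem lift_braidRels {ι : Type} {pos : ι → ℕ} {G : Type*} [Group G] {g : ι → G}
    (h₁ : ∀ i j, pos j = pos i + 1 → g i * g j * g i = g j * g i * g j)
    (h₂ : ∀ i j, pos i + 2 ≤ pos j → g i * g j = g j * g i) :
    ∀ r ∈ braidRels pos, FreeGroup.lift g r = 1 := by
  rintro r (⟨i, j, h, rfl⟩ | ⟨i, j, h, rfl⟩)
  · simp only [map_mul, map_inv, FreeGroup.lift_apply_of]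
    rw [h₁ i j h, mul_inv_cancel]
  · simp only [map_mul, map_inv, FreeGroup.lift_apply_of]
    rw [h₂ i j h, mul_inv_cancel]

theorem of_braid {ι : Type} {pos : ι → ℕ} {i j : ι} (h : pos j = pos i + 1) :
    (PresentedGroup.of i * PresentedGroup.of j * PresentedGroup.of i :
      PresentedGroup (braidRels pos)) =
    PresentedGroup.of j * PresentedGroup.of i * PresentedGroup.of j :=
  PresentedGroup.mk_eq_mk_of_mul_inv_mem (Or.inl ⟨i, j, h, rfl⟩)

theorem of_comm {ι : Type} {pos : ι → ℕ} {i j : ι} (h : pos i + 2 ≤ pos j) :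
    (PresentedGroup.of i * PresentedGroup.of j : PresentedGroup (braidRels pos)) =
    PresentedGroup.of j * PresentedGroup.of i :=
  PresentedGroup.mk_eq_mk_of_mul_inv_mem (Or.inr ⟨i, j, h, rfl⟩)

theorem gen_braid (k : ℕ) : gen k * gen (k + 1) * gen k = gen (k + 1) * gen k * gen (k + 1) :=
  of_braid (pos := id) rfl

theorem gen_comm {j k : ℕ} (h : j + 2 ≤ k) : gen j * gen k = gen k * gen j :=
  of_comm (pos := id) h

/-- The braid group `B_l` on the strands at the positions `0, …, l - 1`, inside `B_∞`. -/
def braidSubgroup (l : ℕ) : Subgroup BraidInf :=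
  Subgroup.closure {β | ∃ k, k + 1 < l ∧ β = gen k}

theorem braid_induction {C : BraidInf → Prop} (one : C 1) (gen' : ∀ k, C (gen k))
    (mul : ∀ β γ, C β → C γ → C (β * γ)) (inv : ∀ β, C β → C β⁻¹) (β : BraidInf) : C β := by
  have h : β ∈ Subgroup.closure (Set.range (PresentedGroup.of : ℕ → BraidInf)) := by
    rw [PresentedGroup.closure_range_of]; trivial
  induction h using Subgroup.closure_induction with
  | mem x hx => obtain ⟨k, rfl⟩ := hx; exact gen' k
  | one => exact one
  | mul x y _ _ hx hy => exact mul x y hx hy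
  | inv x _ hx => exact inv x hx

/-- `footHom β t` is the position at the bottom of the strand of `β` that ends at position `t` at
the top. -/
def footHom : BraidInf →* Equiv.Perm ℕ :=
  PresentedGroup.toGroup (f := fun k => Equiv.swap k (k + 1)) <| lift_braidRels
    (by
      rintro i j h
      obtain rfl : j = i + 1 := h
      ext x
      simp only [Equiv.Perm.mul_apply, Equiv.swap_apply_def]
      grind)
    (by
      rintro i j (h : i + 2 ≤ j)
      ext x
      simp only [Equiv.Perm.mul_apply, Equiv.swap_apply_def]
      grind)

@[simp] theorem footHom_gen (k : ℕ) : footHom (gen k) = Equiv.swap k (k + 1) :=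
  PresentedGroup.toGroup.of _

/-- The permutation underlying a braid: `strandPerm β i` is the position at the top of the strand
of `β` that starts at position `i` at the bottom. -/
def strandPerm (β : BraidInf) : Equiv.Perm ℕ := (footHom β)⁻¹

/-- Data for defining a map `eval x : B_∞ → M` letter by letter, depending on a state `x : S` that
is changed by every letter: `act k` is the change of the state under `σ_k`, and `val k x` is the value
of `σ_k` at the state `x`. The conditions say that Artin's relations are respected. -/
structure BraidCocycle (S M : Type) [Group M] where
  act : ℕ → Equiv.Perm S
  val : ℕ → S → M
  act_braid : ∀ k x, act k (act (k + 1) (act k x)) = act (k + 1) (act k (act (k + 1) x))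
  act_comm : ∀ j k, j + 2 ≤ k → ∀ x, act k (act j x) = act j (act k x)
  val_braid : ∀ k x,
    val k x * val (k + 1) (act k x) * val k (act (k + 1) (act k x)) =
      val (k + 1) x * val k (act (k + 1) x) * val (k + 1) (act k (act (k + 1) x))
  val_comm : ∀ j k, j + 2 ≤ k → ∀ x, val j x * val k (act j x) = val k x * val j (act k x)

namespace BraidCocycle

variable {S M : Type} [Group M] (D : BraidCocycle S M)

/-- The letter `σ_k` reads the current state and multiplies the value obtained so far. -/
def step (k : ℕ) : Equiv.Perm (S × M) where
  toFun p := (D.act k p.1, p.2 * D.val k p.1)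
  invFun p := ((D.act k).symm p.1, p.2 * (D.val k ((D.act k).symm p.1))⁻¹)
  left_inv p := by simp
  right_inv p := by simp

/-- The right action of `B_∞` on pairs (state, value). -/
def hom : BraidInf →* (Equiv.Perm (S × M))ᵐᵒᵖ :=
  PresentedGroup.toGroup (f := fun k => MulOpposite.op (D.step k)) <| lift_braidRels
    (by
      rintro i j h
      obtain rfl : j = i + 1 := h
      apply MulOpposite.unop_injective
      ext p : 1
      simp only [MulOpposite.unop_mul, MulOpposite.unop_op, Equiv.Perm.mul_apply]
      exact Prod.ext (D.act_braid i p.1) (by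
        simpa only [step, Equiv.coe_fn_mk, mul_assoc] using
          congrArg (p.2 * ·) (D.val_braid i p.1)))
    (by
      rintro i j (h : i + 2 ≤ j)
      apply MulOpposite.unop_injective
      ext p : 1
      simp only [MulOpposite.unop_mul, MulOpposite.unop_op, Equiv.Perm.mul_apply]
      exact Prod.ext (D.act_comm i j h p.1) (by
        simpa only [step, Equiv.coe_fn_mk, mul_assoc] using
          congrArg (p.2 * ·) (D.val_comm i j h p.1)))

/-- The state after reading the braid `β`, starting at the state `x`. -/
def move (x : S) (β : BraidInf) : S := ((D.hom β).unop (x, 1)).1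

/-- The value of `β` at the state `x`. It is determined by `eval x (σ_k) = val k x` and
`eval x (β γ) = eval x β * eval (move x β) γ`. -/
def eval (x : S) (β : BraidInf) : M := ((D.hom β).unop (x, 1)).2

theorem hom_apply (β : BraidInf) (x : S) (b : M) :
    (D.hom β).unop (x, b) = (D.move x β, b * D.eval x β) := by
  have key : ∀ (a b : M) (x : S), (D.hom β).unop (x, a * b) =
      (((D.hom β).unop (x, b)).1, a * ((D.hom β).unop (x, b)).2) := by
    induction β using braid_induction with
    | one => simp
    | gen' k => intro a b x; simp [hom, gen, step, mul_assoc]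
    | mul β γ hβ hγ =>
      intro a b x
      simp only [map_mul, MulOpposite.unop_mul, Equiv.Perm.mul_apply]
      rw [hβ, hγ]
    | inv β hβ =>
      intro a b x
      simp only [map_inv, MulOpposite.unop_inv]
      rw [Equiv.Perm.inv_eq_iff_eq, hβ]
      simp
  simpa [move, eval] using key b 1 x

@[simp] theorem move_gen (x : S) (k : ℕ) : D.move x (gen k) = D.act k x := by
  simp [move, hom, gen, step]

@[simp] theorem eval_gen (x : S) (k : ℕ) : D.eval x (gen k) = D.val k x := by
  simp [eval, hom, gen, step]

@[simp] theorem move_one (x : S) : D.move x 1 = x := by simp [move]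

@[simp] theorem eval_one (x : S) : D.eval x 1 = 1 := by simp [eval]

theorem move_mul (x : S) (β γ : BraidInf) : D.move x (β * γ) = D.move (D.move x β) γ := by
  have := D.hom_apply (β * γ) x 1
  simp only [map_mul, MulOpposite.unop_mul, Equiv.Perm.mul_apply, hom_apply] at this
  exact (congrArg Prod.fst this).symm

theorem eval_mul (x : S) (β γ : BraidInf) :
    D.eval x (β * γ) = D.eval x β * D.eval (D.move x β) γ := by
  have := D.hom_apply (β * γ) x 1
  simp only [map_mul, MulOpposite.unop_mul, Equiv.Perm.mul_apply, hom_apply] at this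
  simpa using (congrArg Prod.snd this).symm

end BraidCocycle


section Blocks

variable {G : Type} [Group G] {a b c : G}

theorem block₁ (h₁ : a * b * a = b * a * b) (h₂ : b * c * b = c * b * c) (h₃ : a * c = c * a) :
    b * a * (c * b) * a = c * (b * a) * (c * b) :=
  calc b * a * (c * b) * a = b * (a * c) * b * a := by group
    _ = b * c * (a * b * a) := by rw [h₃]; group
    _ = (b * c * b) * a * b := by rw [h₁]; group
    _ = c * b * (c * a) * b := by rw [h₂]; group
    _ = c * (b * a) * (c * b) := by rw [← h₃]; group

theorem block₂ (h₁ : a * b * a = b * a * b) (h₂ : b * c * b = c * b * c) (h₃ : a * c = c * a) :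
    a * b * c * (b * a) = c * b * a * (b * c) :=
  calc a * b * c * (b * a) = a * (b * c * b) * a := by group
    _ = (a * c) * b * (c * a) := by rw [h₂]; group
    _ = c * a * b * (c * a) := by rw [h₃]
    _ = c * a * b * (a * c) := by rw [h₃]
    _ = c * (a * b * a) * c := by group
    _ = c * b * a * (b * c) := by rw [h₁]; group

theorem block₃ (h₁ : a * b * a = b * a * b) (h₂ : b * c * b = c * b * c) (h₃ : a * c = c * a) :
    a * (b * c) * (a * b) = b * c * (a * b) * c :=
  calc a * (b * c) * (a * b) = a * b * (c * a) * b := by group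
    _ = (a * b * a) * c * b := by rw [← h₃]; group
    _ = b * a * (b * c * b) := by rw [h₁]; group
    _ = b * (a * c) * b * c := by rw [h₂]; group
    _ = b * c * (a * b) * c := by rw [h₃]; group

end Blocks

/-- The crossing `σ_k` after doubling the strand that is at position `i` at the bottom. -/
def cableVal (k i : ℕ) : BraidInf :=
  if i < k then gen (k + 1)
  else if i = k then gen (k + 1) * gen k
  else if i = k + 1 then gen k * gen (k + 1)
  else gen k

theorem cableVal_lt {k i : ℕ} (h : i < k) : cableVal k i = gen (k + 1) := if_pos h
theorem cableVal_self (k : ℕ) : cableVal k k = gen (k + 1) * gen k := by simp [cableVal]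
theorem cableVal_succ (k : ℕ) : cableVal k (k + 1) = gen k * gen (k + 1) := by simp [cableVal]
theorem cableVal_gt {k i : ℕ} (h : k + 1 < i) : cableVal k i = gen k := by
  unfold cableVal; grind

theorem swap_lt {k i : ℕ} (h : i < k) : Equiv.swap k (k + 1) i = i :=
  Equiv.swap_apply_of_ne_of_ne (by omega) (by omega)
theorem swap_gt {k i : ℕ} (h : k + 1 < i) : Equiv.swap k (k + 1) i = i :=
  Equiv.swap_apply_of_ne_of_ne (by omega) (by omega)

/-- Doubling a strand; the state is the position of the strand that is doubled. -/
def cableCocycle : BraidCocycle ℕ BraidInf where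
  act k := Equiv.swap k (k + 1)
  val := cableVal
  act_braid k x := by
    simp only [Equiv.swap_apply_def]; grind
  act_comm j k h x := by
    simp only [Equiv.swap_apply_def]; grind
  val_braid k x := by
    have h1 := gen_braid k
    have h2 : gen (k + 1) * gen (k + 2) * gen (k + 1) =
      gen (k + 2) * gen (k + 1) * gen (k + 2) := gen_braid (k + 1)
    have h3 : gen k * gen (k + 2) = gen (k + 2) * gen k := gen_comm le_rfl
    have hx : x < k ∨ x = k ∨ x = k + 1 ∨ x = k + 2 ∨ k + 2 < x := by omega
    have s1 : Equiv.swap (k + 1) (k + 1 + 1) k = k := swap_lt (by omega)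
    have s2 : Equiv.swap k (k + 1) (k + 2) = k + 2 := swap_gt (by omega)
    have s3 : Equiv.swap (k + 1) (k + 1 + 1) (k + 1) = k + 2 := Equiv.swap_apply_left _ _
    have s4 : Equiv.swap (k + 1) (k + 1 + 1) (k + 2) = k + 1 := Equiv.swap_apply_right _ _
    have v1 : cableVal (k + 1) (k + 2) = gen (k + 1) * gen (k + 2) := cableVal_succ (k + 1)
    have v2 : cableVal (k + 1) (k + 1) = gen (k + 2) * gen (k + 1) := cableVal_self (k + 1)
    rcases hx with h | rfl | rfl | rfl | h
    · simp only [swap_lt h, swap_lt (Nat.lt_succ_of_lt h), cableVal_lt h,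
        cableVal_lt (Nat.lt_succ_of_lt h)]
      exact h2
    · simp only [s1, s3, Equiv.swap_apply_left, cableVal_self,
        cableVal_lt (Nat.lt_succ_self _), cableVal_gt (Nat.lt_succ_self _)]
      exact block₁ h1 h2 h3
    · simp only [s1, s2, s3, Equiv.swap_apply_right, cableVal_self, cableVal_succ,
        cableVal_lt (Nat.lt_succ_self _), cableVal_gt (Nat.lt_succ_self _)]
      exact block₂ h1 h2 h3
    · simp only [s2, s4, Equiv.swap_apply_right, cableVal_succ,
        cableVal_lt (Nat.lt_succ_self _), cableVal_gt (Nat.lt_succ_self _)]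
      exact block₃ h1 h2 h3
    · have h' : k + 1 < x := by omega
      have h'' : k + 1 + 1 < x := by omega
      simp only [swap_gt h', swap_gt h'', cableVal_gt h', cableVal_gt h'']
      exact h1
  val_comm j k h x := by
    have h1 := gen_comm h
    have h2 : gen (j + 1) * gen (k + 1) = gen (k + 1) * gen (j + 1) := gen_comm (by omega)
    have h3 : gen j * gen (k + 1) = gen (k + 1) * gen j := gen_comm (by omega)
    have hx : x < j ∨ x = j ∨ x = j + 1 ∨ (j + 1 < x ∧ x < k) ∨ x = k ∨ x = k + 1 ∨ k + 1 < x := by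
      omega
    rcases hx with h | rfl | rfl | ⟨h, h'⟩ | rfl | rfl | h'
    · have h' : x < k := by omega
      simp only [swap_lt h, swap_lt h', cableVal_lt h, cableVal_lt h']
      exact h2
    · have h' : x < k := by omega
      have h'' : x + 1 < k := by omega
      simp only [swap_lt h', Equiv.swap_apply_left, cableVal_self, cableVal_lt h', cableVal_lt h'']
      rw [mul_assoc, h3, ← mul_assoc, h2, mul_assoc]
    · have h' : j < k := by omega
      have h'' : j + 1 < k := by omega
      simp only [swap_lt h'', Equiv.swap_apply_right, cableVal_succ, cableVal_lt h',
        cableVal_lt h'']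
      rw [mul_assoc, h2, ← mul_assoc, h3, mul_assoc]
    · simp only [swap_gt h, swap_lt h', cableVal_gt h, cableVal_lt h']
      exact h3
    · have h' : j + 1 < x := by omega
      have h'' : j + 1 < x + 1 := by omega
      simp only [swap_gt h', Equiv.swap_apply_left, cableVal_self, cableVal_gt h', cableVal_gt h'']
      rw [← mul_assoc, h3, mul_assoc, h1, mul_assoc]
    · have h' : j + 1 < k := by omega
      have h'' : j + 1 < k + 1 := by omega
      simp only [swap_gt h'', Equiv.swap_apply_right, cableVal_succ, cableVal_gt h',
        cableVal_gt h'']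
      rw [← mul_assoc, h1, mul_assoc, h3, mul_assoc]
    · have h : j + 1 < x := by omega
      simp only [swap_gt h, swap_gt h', cableVal_gt h, cableVal_gt h']
      exact h1


/-- The number of poles at positions `< n` in the coloring `c`. -/
def polesBelow (c : ℕ → Color) (n : ℕ) : ℕ := Nat.count (fun i => c i = Color.pole) n

/-- The effect of the crossing `σ_k` on the colors of the end points. -/
def permuteColors (k : ℕ) : Equiv.Perm (ℕ → Color) where
  toFun c := c ∘ Equiv.swap k (k + 1)
  invFun c := c ∘ Equiv.swap k (k + 1)
  left_inv c := by ext x; simp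
  right_inv c := by ext x; simp

/-- The crossing `σ_k` after forgetting all blue strands: it survives if and only if both of its
strands are poles, and its new position is the number of poles to the left of it. -/
def forgetVal {M : Type} [Group M] (g : ℕ → M) (k : ℕ) (c : ℕ → Color) : M :=
  if c k = Color.pole ∧ c (k + 1) = Color.pole then g (polesBelow c k) else 1

theorem polesBelow_succ (c : ℕ → Color) (n : ℕ) :
    polesBelow c (n + 1) = polesBelow c n + if c n = Color.pole then 1 else 0 :=
  Nat.count_succ _ _

theorem polesBelow_congr {c c' : ℕ → Color} {n : ℕ} (h : ∀ i < n, c i = c' i) :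
    polesBelow c n = polesBelow c' n := by
  induction n with
  | zero => rfl
  | succ n ih =>
    rw [polesBelow_succ, polesBelow_succ, ih fun i hi => h i (by omega), h n (by omega)]

theorem permuteColors_apply (k : ℕ) (c : ℕ → Color) (x : ℕ) :
    permuteColors k c x = c (if x = k then k + 1 else if x = k + 1 then k else x) := by
  simp [permuteColors, Equiv.swap_apply_def]

theorem permuteColors_self (k : ℕ) (c : ℕ → Color) : permuteColors k c k = c (k + 1) := by
  simp [permuteColors_apply]

theorem permuteColors_succ (k : ℕ) (c : ℕ → Color) : permuteColors k c (k + 1) = c k := by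
  simp [permuteColors_apply]

theorem permuteColors_ne {k x : ℕ} (h : x ≠ k) (h' : x ≠ k + 1) (c : ℕ → Color) :
    permuteColors k c x = c x := by
  simp [permuteColors_apply, h, h']

theorem polesBelow_permute_le {k n : ℕ} (h : n ≤ k) (c : ℕ → Color) :
    polesBelow (permuteColors k c) n = polesBelow c n :=
  polesBelow_congr fun i hi => permuteColors_ne (by omega) (by omega) c

theorem polesBelow_permute_ge {k n : ℕ} (h : k + 2 ≤ n) (c : ℕ → Color) :
    polesBelow (permuteColors k c) n = polesBelow c n := by
  induction n, h using Nat.le_induction with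
  | base =>
    rw [polesBelow_succ, polesBelow_succ, polesBelow_succ, polesBelow_succ, permuteColors_self,
      permuteColors_succ, polesBelow_permute_le le_rfl]
    omega
  | succ n h ih =>
    rw [polesBelow_succ, polesBelow_succ, ih, permuteColors_ne (by omega) (by omega)]

theorem permuteColors_braid (k : ℕ) (c : ℕ → Color) :
    permuteColors k (permuteColors (k + 1) (permuteColors k c)) =
      permuteColors (k + 1) (permuteColors k (permuteColors (k + 1) c)) := by
  ext x
  simp only [permuteColors_apply]
  grind

theorem permuteColors_comm {j k : ℕ} (h : j + 2 ≤ k) (c : ℕ → Color) :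
    permuteColors k (permuteColors j c) = permuteColors j (permuteColors k c) := by
  ext x
  simp only [permuteColors_apply]
  grind

theorem forgetVal_braid {M : Type} [Group M] (g : ℕ → M) (k : ℕ) (c : ℕ → Color)
    (hg : c k = Color.pole → c (k + 1) = Color.pole → c (k + 2) = Color.pole →
      g (polesBelow c k) * g (polesBelow c k + 1) * g (polesBelow c k) =
        g (polesBelow c k + 1) * g (polesBelow c k) * g (polesBelow c k + 1)) :
    forgetVal g k c * forgetVal g (k + 1) (permuteColors k c) *
        forgetVal g k (permuteColors (k + 1) (permuteColors k c)) =
      forgetVal g (k + 1) c * forgetVal g k (permuteColors (k + 1) c) *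
        forgetVal g (k + 1) (permuteColors k (permuteColors (k + 1) c)) := by
  have e : k + 1 + 1 = k + 2 := rfl
  have s1 : ∀ c, permuteColors (k + 1) c k = c k := fun c =>
    permuteColors_ne (by omega) (by omega) c
  have s2 : ∀ c, permuteColors k c (k + 2) = c (k + 2) := fun c =>
    permuteColors_ne (by omega) (by omega) c
  have s3 : ∀ c, permuteColors (k + 1) c (k + 2) = c (k + 1) := permuteColors_succ (k + 1)
  have p1 : ∀ c, polesBelow (permuteColors (k + 1) c) k = polesBelow c k := fun c =>
    polesBelow_permute_le (by omega) c
  simp only [forgetVal, e, s1, s2, s3, permuteColors_self, permuteColors_succ, polesBelow_succ,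
    polesBelow_permute_le le_rfl, p1]
  rcases h0 : c k with _ | _ <;> rcases h1 : c (k + 1) with _ | _ <;>
    rcases h2 : c (k + 2) with _ | _ <;> simp
  simpa using hg h0 h1 h2

theorem forgetVal_comm {M : Type} [Group M] (g : ℕ → M) {j k : ℕ} (h : j + 2 ≤ k) (c : ℕ → Color)
    (hg : c j = Color.pole → c (j + 1) = Color.pole → c k = Color.pole →
      c (k + 1) = Color.pole →
      g (polesBelow c j) * g (polesBelow c k) = g (polesBelow c k) * g (polesBelow c j)) :
    forgetVal g j c * forgetVal g k (permuteColors j c) =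
      forgetVal g k c * forgetVal g j (permuteColors k c) := by
  simp only [forgetVal, polesBelow_permute_le (show j ≤ k by omega), polesBelow_permute_ge h,
    permuteColors_ne (show j ≠ k by omega) (show j ≠ k + 1 by omega),
    permuteColors_ne (show j + 1 ≠ k by omega) (show j + 1 ≠ k + 1 by omega),
    permuteColors_ne (show k ≠ j by omega) (show k ≠ j + 1 by omega),
    permuteColors_ne (show k + 1 ≠ j by omega) (show k + 1 ≠ j + 1 by omega)]
  by_cases h1 : c j = Color.pole ∧ c (j + 1) = Color.pole <;>
    by_cases h2 : c k = Color.pole ∧ c (k + 1) = Color.pole <;> simp [h1, h2]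
  exact hg h1.1 h1.2 h2.1 h2.2

theorem polesBelow_add_two_le {c : ℕ → Color} {j k : ℕ} (h : j + 2 ≤ k) (h₀ : c j = Color.pole)
    (h₁ : c (j + 1) = Color.pole) : polesBelow c j + 2 ≤ polesBelow c k := by
  have : polesBelow c (j + 2) = polesBelow c j + 2 := by
    rw [polesBelow_succ, polesBelow_succ]; simp [h₀, h₁]
  rw [← this]
  exact Nat.count_monotone _ h

/-- Forgetting all blue strands; the state is the coloring of the end points. -/
def forgetCocycle : BraidCocycle (ℕ → Color) BraidInf where
  act := permuteColors
  val := forgetVal gen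
  act_braid := permuteColors_braid
  act_comm _ _ h c := permuteColors_comm h c
  val_braid k c := forgetVal_braid gen k c fun _ _ _ => gen_braid _
  val_comm _ _ h c := forgetVal_comm gen h c fun h₀ h₁ _ _ =>
    gen_comm (polesBelow_add_two_le h h₀ h₁)

/-- The braid obtained from `β`, colored by `c` at the bottom, by forgetting all blue strands. -/
def forget (c : ℕ → Color) (β : BraidInf) : BraidInf := forgetCocycle.eval c β

/-- The braid obtained from `β` by doubling the strand at position `i` at the bottom. -/
def cable (i : ℕ) (β : BraidInf) : BraidInf := cableCocycle.eval i β

theorem forget_move (c : ℕ → Color) (β : BraidInf) :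
    forgetCocycle.move c β = c ∘ footHom β := by
  induction β using braid_induction generalizing c with
  | one => ext; simp
  | gen' k => simp [forgetCocycle, permuteColors]
  | mul β γ hβ hγ => rw [BraidCocycle.move_mul, hβ, hγ]; ext; simp
  | inv β hβ =>
    have h := forgetCocycle.move_mul (c ∘ ⇑(footHom β⁻¹)) β β⁻¹
    rw [mul_inv_cancel, BraidCocycle.move_one, hβ] at h
    rw [h]; congr 1; ext; simp

theorem strandPerm_mul (β γ : BraidInf) :
    strandPerm (β * γ) = (strandPerm β).trans (strandPerm γ) := by
  ext; simp [strandPerm]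

theorem cable_move (i : ℕ) (β : BraidInf) : cableCocycle.move i β = strandPerm β i := by
  induction β using braid_induction generalizing i with
  | one => simp [strandPerm]
  | gen' k => simp [cableCocycle, strandPerm]
  | mul β γ hβ hγ => rw [BraidCocycle.move_mul, hβ, hγ]; simp [strandPerm]
  | inv β hβ =>
    have h := cableCocycle.move_mul (strandPerm β⁻¹ i) β β⁻¹
    rw [mul_inv_cancel, BraidCocycle.move_one, hβ] at h
    rw [h]; congr 1; simp [strandPerm]

theorem forget_mul (c : ℕ → Color) (β γ : BraidInf) :
    forget c (β * γ) = forget c β * forget (c ∘ footHom β) γ := by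
  rw [forget, BraidCocycle.eval_mul, forget_move]; rfl

theorem cable_mul (i : ℕ) (β γ : BraidInf) :
    cable i (β * γ) = cable i β * cable (strandPerm β i) γ := by
  rw [cable, BraidCocycle.eval_mul, cable_move]; rfl

theorem cocycle_ext {S M : Type} [Group M] {act : S → BraidInf → S}
    (act_mul : ∀ x β γ, act x (β * γ) = act (act x β) γ) (act_one : ∀ x, act x 1 = x)
    {F G : S → BraidInf → M}
    (hF : ∀ x β γ, F x (β * γ) = F x β * F (act x β) γ)
    (hG : ∀ x β γ, G x (β * γ) = G x β * G (act x β) γ)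
    (h : ∀ x k, F x (gen k) = G x (gen k)) (x : S) (β : BraidInf) : F x β = G x β := by
  have F1 : ∀ x, F x 1 = 1 := fun x => by simpa [act_one] using hF x 1 1
  have G1 : ∀ x, G x 1 = 1 := fun x => by simpa [act_one] using hG x 1 1
  induction β using braid_induction generalizing x with
  | one => rw [F1, G1]
  | gen' k => exact h x k
  | mul β γ hβ hγ => rw [hF, hG, hβ, hγ]
  | inv β hβ =>
    have h1 := hF (act x β⁻¹) β β⁻¹
    have h2 := hG (act x β⁻¹) β β⁻¹
    rw [mul_inv_cancel, F1, ← act_mul, inv_mul_cancel, act_one] at h1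
    rw [mul_inv_cancel, G1, ← act_mul, inv_mul_cancel, act_one] at h2
    rw [← mul_right_inj (F (act x β⁻¹) β), ← h1, hβ, ← h2]


/-- The generator `σ_k` of Artin's braid group, or `1` if there is none. -/
def genOrOne (l k : ℕ) : ArtinBraidGroup l :=
  if h : k < l - 1 then PresentedGroup.of ⟨k, h⟩ else 1

theorem genOrOne_braid {l k : ℕ} (h : k + 2 < l) :
    genOrOne l k * genOrOne l (k + 1) * genOrOne l k =
      genOrOne l (k + 1) * genOrOne l k * genOrOne l (k + 1) := by
  rw [genOrOne, genOrOne, dif_pos (by omega), dif_pos (by omega)]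
  exact of_braid (pos := (Fin.val : Fin (l - 1) → ℕ)) rfl

theorem genOrOne_comm {l j k : ℕ} (h : j + 2 ≤ k) (hk : k + 1 < l) :
    genOrOne l j * genOrOne l k = genOrOne l k * genOrOne l j := by
  rw [genOrOne, genOrOne, dif_pos (by omega), dif_pos (by omega)]
  exact of_comm (pos := (Fin.val : Fin (l - 1) → ℕ)) h

/-- There are at most `l` poles. -/
def AtMostPoles (l : ℕ) (c : ℕ → Color) : Prop := ∀ n, polesBelow c n ≤ l

theorem atMostPoles_permute (l k : ℕ) (c : ℕ → Color) :
    AtMostPoles l (permuteColors k c) ↔ AtMostPoles l c := by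
  have key : ∀ c, AtMostPoles l c → AtMostPoles l (permuteColors k c) := by
    intro c h n
    have h1 : polesBelow (permuteColors k c) n ≤ polesBelow (permuteColors k c) (n + k + 2) :=
      Nat.count_monotone _ (by omega)
    rw [polesBelow_permute_ge (n := n + k + 2) (by omega)] at h1
    exact h1.trans (h _)
  refine ⟨fun h => ?_, key c⟩
  have := key _ h
  rwa [show permuteColors k (permuteColors k c) = c from (permuteColors k).left_inv c] at this

open Classical in
noncomputable def retractCocycle (l : ℕ) : BraidCocycle (ℕ → Color) (ArtinBraidGroup l) where
  act := permuteColors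
  val k c := if AtMostPoles l c then forgetVal (genOrOne l) k c else 1
  act_braid := permuteColors_braid
  act_comm _ _ h c := permuteColors_comm h c
  val_braid k c := by
    simp only [atMostPoles_permute]
    split_ifs with hc
    · refine forgetVal_braid _ k c fun h₀ h₁ h₂ => genOrOne_braid ?_
      have := hc (k + 3)
      rw [polesBelow_succ, polesBelow_succ, polesBelow_succ] at this
      simp only [h₀, h₁, h₂, if_true] at this
      omega
    · rfl
  val_comm j k h c := by
    simp only [atMostPoles_permute]
    split_ifs with hc
    · refine forgetVal_comm _ h c fun h₀ h₁ h₂ h₃ =>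
        genOrOne_comm (polesBelow_add_two_le h h₀ h₁) ?_
      have := hc (k + 2)
      rw [polesBelow_succ, polesBelow_succ] at this
      simp only [h₂, h₃, if_true] at this
      omega
    · rfl

/-- The homomorphism from Artin's braid group on `l` strands to `B_∞`. -/
def toInf (l : ℕ) : ArtinBraidGroup l →* BraidInf :=
  PresentedGroup.toGroup (f := fun k : Fin (l - 1) => gen k) <| lift_braidRels
    (fun i j h => by rw [h]; exact gen_braid i)
    (fun i j h => gen_comm h)

@[simp] theorem toInf_of (l : ℕ) (k : Fin (l - 1)) : toInf l (PresentedGroup.of k) = gen k :=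
  PresentedGroup.toGroup.of _

theorem toInf_injective (l : ℕ) : Function.Injective (toInf l) := by
  let c₀ : ℕ → Color := fun i => if i < l then Color.pole else Color.strand
  have hp : ∀ n, polesBelow c₀ n = min n l := by
    intro n
    induction n with
    | zero => simp [polesBelow]
    | succ n ih =>
      rw [polesBelow_succ, ih]
      by_cases h : n < l <;> simp [c₀, h] <;> omega
  have key : ∀ x : ArtinBraidGroup l, (retractCocycle l).move c₀ (toInf l x) = c₀ ∧
      (retractCocycle l).eval c₀ (toInf l x) = x := by
    intro x
    have hx : x ∈ Subgroup.closure (Set.range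
        (PresentedGroup.of : Fin (l - 1) → ArtinBraidGroup l)) := by
      rw [PresentedGroup.closure_range_of]; trivial
    induction hx using Subgroup.closure_induction with
    | mem x hx =>
      obtain ⟨k, rfl⟩ := hx
      have hk := k.2
      have hc : AtMostPoles l c₀ := fun n => by rw [hp]; omega
      refine ⟨?_, ?_⟩
      · rw [toInf_of, BraidCocycle.move_gen]
        ext x
        simp only [retractCocycle, permuteColors_apply, c₀]
        grind
      · rw [toInf_of, BraidCocycle.eval_gen]
        have h1 : c₀ (k : ℕ) = Color.pole := by simp only [c₀]; grind
        have h2 : c₀ ((k : ℕ) + 1) = Color.pole := by simp only [c₀]; grind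
        simp only [retractCocycle, if_pos hc, forgetVal, h1, h2, and_self, if_true, hp]
        rw [min_eq_left (by omega), genOrOne, dif_pos hk]
    | one => simp
    | mul x y _ _ hx hy =>
      rw [map_mul, BraidCocycle.move_mul, BraidCocycle.eval_mul, hx.1, hx.2, hy.1, hy.2]
      exact ⟨rfl, rfl⟩
    | inv x _ hx =>
      have h1 := (retractCocycle l).move_mul c₀ (toInf l x) (toInf l x⁻¹)
      have h2 := (retractCocycle l).eval_mul c₀ (toInf l x) (toInf l x⁻¹)
      rw [hx.1, ← map_mul, mul_inv_cancel, map_one, BraidCocycle.move_one] at h1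
      rw [hx.1, hx.2, ← map_mul, mul_inv_cancel, map_one, BraidCocycle.eval_one] at h2
      exact ⟨h1.symm, (inv_eq_of_mul_eq_one_right h2.symm).symm⟩
  intro x y h
  rw [← (key x).2, ← (key y).2, h]

theorem toInf_range (l : ℕ) : (toInf l).range = braidSubgroup l := by
  rw [MonoidHom.range_eq_map, ← PresentedGroup.closure_range_of, MonoidHom.map_closure,
    braidSubgroup]
  congr 1
  ext β
  constructor
  · rintro ⟨_, ⟨k, rfl⟩, rfl⟩
    exact ⟨k, by have := k.2; omega, toInf_of l k⟩
  · rintro ⟨k, hk, rfl⟩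
    exact ⟨_, ⟨⟨k, by omega⟩, rfl⟩, toInf_of l _⟩

/-- The subgroup `braidSubgroup l` of `B_∞` is Artin's braid group on `l` strands. -/
noncomputable def artinEquiv (l : ℕ) : ArtinBraidGroup l ≃* braidSubgroup l :=
  (MonoidHom.ofInjective (toInf_injective l)).trans (MulEquiv.subgroupCongr (toInf_range l))

theorem artinEquiv_of (l : ℕ) (k : Fin (l - 1)) :
    (artinEquiv l (PresentedGroup.of k) : BraidInf) = gen k :=
  toInf_of l k

/-- Adding a straight strand on the left. -/
def shift : BraidInf →* BraidInf :=
  PresentedGroup.toGroup (f := fun k => gen (k + 1)) <| lift_braidRels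
    (by rintro i j h; obtain rfl : j = i + 1 := h; exact gen_braid (i + 1))
    (by rintro i j (h : i + 2 ≤ j); exact gen_comm (by omega))

@[simp] theorem shift_gen (k : ℕ) : shift (gen k) = gen (k + 1) := PresentedGroup.toGroup.of _

/-- After doubling the position `i`: the new positions are the old ones, where `i` stands for the
first copy, and `none`, which is the second copy and sits at the position `i + 1`. -/
def doubling (i : ℕ) : ℕ ≃ Option ℕ where
  toFun x := if x ≤ i then some x else if x = i + 1 then none else some (x - 1)
  invFun y := y.elim (i + 1) fun x => if x ≤ i then x else x + 1
  left_inv x := by dsimp only; split_ifs <;> simp <;> grind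
  right_inv y := by
    cases y with
    | none => simp
    | some x => simp only [Option.elim]; grind

/-- The permutation `σ` after doubling the strand at position `i` at the bottom. -/
def cablePerm (i : ℕ) (σ : Equiv.Perm ℕ) : Equiv.Perm ℕ :=
  (doubling i).trans ((Equiv.optionCongr σ).trans (doubling (σ i)).symm)

/-- The permutation `σ` after adding a straight strand on the left. -/
def shiftPerm (σ : Equiv.Perm ℕ) : Equiv.Perm ℕ where
  toFun x := Nat.casesOn x 0 fun y => σ y + 1
  invFun x := Nat.casesOn x 0 fun y => σ.symm y + 1
  left_inv x := by cases x <;> simp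
  right_inv x := by cases x <;> simp

@[simp] theorem shiftPerm_zero (σ : Equiv.Perm ℕ) : shiftPerm σ 0 = 0 := rfl
@[simp] theorem shiftPerm_succ (σ : Equiv.Perm ℕ) (x : ℕ) : shiftPerm σ (x + 1) = σ x + 1 := rfl

theorem cablePerm_apply (i : ℕ) (σ : Equiv.Perm ℕ) (x : ℕ) :
    cablePerm i σ x =
      if x = i + 1 then σ i + 1
      else if σ (if x ≤ i then x else x - 1) ≤ σ i then σ (if x ≤ i then x else x - 1)
      else σ (if x ≤ i then x else x - 1) + 1 := by
  by_cases h1 : x ≤ i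
  · have h2 : x ≠ i + 1 := by omega
    simp [cablePerm, doubling, h1, h2]
  · by_cases h2 : x = i + 1 <;> simp [cablePerm, doubling, h1, h2]

theorem cablePerm_trans (i : ℕ) (σ τ : Equiv.Perm ℕ) :
    cablePerm i (σ.trans τ) = (cablePerm i σ).trans (cablePerm (σ i) τ) := by
  ext x
  simp only [cablePerm, Equiv.trans_apply, Equiv.apply_symm_apply, Equiv.optionCongr_apply]
  rcases doubling i x with _ | y <;> simp

theorem footHom_gen_apply (k x : ℕ) :
    footHom (gen k) x = if x = k then k + 1 else if x = k + 1 then k else x := by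
  simp [Equiv.swap_apply_def]

theorem cable_gen (i k : ℕ) : cable i (gen k) = cableVal k i :=
  cableCocycle.eval_gen i k

theorem forget_gen (c : ℕ → Color) (k : ℕ) : forget c (gen k) = forgetVal gen k c :=
  forgetCocycle.eval_gen c k

theorem forget_one (c : ℕ → Color) : forget c 1 = 1 := forgetCocycle.eval_one c

theorem cable_one (i : ℕ) : cable i 1 = 1 := cableCocycle.eval_one i

theorem footHom_eq (β : BraidInf) : footHom β = (strandPerm β)⁻¹ := by simp [strandPerm]

theorem strandPerm_gen (k : ℕ) : strandPerm (gen k) = Equiv.swap k (k + 1) := by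
  simp [strandPerm]

theorem footHom_cable (i : ℕ) (β : BraidInf) :
    footHom (cable i β) = (cablePerm i (strandPerm β))⁻¹ := by
  refine cocycle_ext (act := fun i β => strandPerm β i)
    (F := fun i β => footHom (cable i β)) (G := fun i β => (cablePerm i (strandPerm β))⁻¹)
    ?_ ?_ ?_ ?_ ?_ i β
  · intro x β γ; simp [strandPerm_mul]
  · intro x; simp [strandPerm]
  · intro x β γ; simp [cable_mul]
  · intro x β γ
    simp only [strandPerm_mul, cablePerm_trans]
    ext; simp [Equiv.Perm.inv_def]
  · intro i k
    rw [cable_gen, eq_inv_iff_mul_eq_one, strandPerm_gen]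
    ext x
    simp only [Equiv.Perm.mul_apply, cablePerm_apply, cableVal, Equiv.swap_apply_def,
      Equiv.Perm.one_apply]
    split_ifs <;> simp only [map_mul, Equiv.Perm.mul_apply, footHom_gen_apply] <;> grind

theorem strandPerm_cable (i : ℕ) (β : BraidInf) :
    strandPerm (cable i β) = cablePerm i (strandPerm β) := by
  rw [strandPerm, footHom_cable, inv_inv]

theorem strandPerm_shift (β : BraidInf) : strandPerm (shift β) = shiftPerm (strandPerm β) := by
  induction β using braid_induction with
  | one => ext x; cases x <;> simp [strandPerm]
  | gen' k =>
    ext x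
    rcases x with _ | x
    · simp [strandPerm, Equiv.swap_apply_def]
    · simp only [shift_gen, strandPerm_gen, shiftPerm_succ, Equiv.swap_apply_def]; grind
  | mul β γ hβ hγ =>
    rw [map_mul, strandPerm_mul, strandPerm_mul, hβ, hγ]
    ext x; cases x <;> simp
  | inv β hβ =>
    have e : ∀ γ, strandPerm γ⁻¹ = (strandPerm γ).symm := fun γ => by
      ext; simp [strandPerm, Equiv.Perm.inv_def]
    rw [map_inv, e, e, hβ]
    ext x; cases x <;> rfl

/-- The coloring after doubling position `i`. -/
def cableColors (c : ℕ → Color) (i x : ℕ) : Color := c (if x ≤ i then x else x - 1)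

/-- The coloring after adding the color `d` on the left. -/
def shiftColors (d : Color) (c : ℕ → Color) (x : ℕ) : Color := Nat.casesOn x d c

theorem forget_perm (c : ℕ → Color) (i : ℕ) (hi : c i = Color.pole) (β : BraidInf) :
    strandPerm (forget c β) (polesBelow c i) =
      polesBelow (c ∘ footHom β) (strandPerm β i) := by
  induction β using braid_induction generalizing c i with
  | one => simp [forget_one, strandPerm]
  | gen' k =>
    have hc : c ∘ ⇑(footHom (gen k)) = permuteColors k c := by simp [permuteColors]
    rw [hc, strandPerm_gen, forget_gen, forgetVal]
    rcases lt_trichotomy i k with h | rfl | h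
    · rw [swap_lt h, polesBelow_permute_le h.le]
      split_ifs with hk
      · have : polesBelow c i < polesBelow c k := Nat.count_strict_mono hi h
        rw [strandPerm_gen, swap_lt this]
      · simp [strandPerm]
    · rw [Equiv.swap_apply_left, polesBelow_succ, polesBelow_permute_le le_rfl, permuteColors_self]
      simp only [hi, true_and]
      split_ifs with hk
      · simp [strandPerm_gen]
      · simp [strandPerm]
    · rcases (show i = k + 1 ∨ k + 1 < i by omega) with rfl | h
      · rw [Equiv.swap_apply_right, polesBelow_succ, polesBelow_permute_le le_rfl]
        simp only [hi, and_true]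
        split_ifs with hk
        · simp [strandPerm_gen]
        · simp [strandPerm]
      · rw [swap_gt h, polesBelow_permute_ge h]
        split_ifs with hk
        · have := polesBelow_add_two_le (k := i) h hk.1 hk.2
          rw [strandPerm_gen, swap_gt (by omega)]
        · simp [strandPerm]
  | mul β γ hβ hγ =>
    rw [forget_mul, strandPerm_mul, strandPerm_mul, Equiv.trans_apply, Equiv.trans_apply,
      hβ c i hi, hγ _ _ (by simpa [strandPerm] using hi)]
    congr 1; ext; simp
  | inv β hβ =>
    have h := hβ (c ∘ ⇑(footHom β⁻¹)) (strandPerm β⁻¹ i) (by simpa [strandPerm] using hi)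
    have e : (c ∘ ⇑(footHom β⁻¹)) ∘ ⇑(footHom β) = c := by ext; simp
    have e' : strandPerm β (strandPerm β⁻¹ i) = i := by simp [strandPerm]
    rw [e, e'] at h
    have m := forget_mul c β⁻¹ β
    rw [inv_mul_cancel, forget_one] at m
    rw [eq_inv_of_mul_eq_one_left m.symm, ← h]
    simp [strandPerm]

theorem polesBelow_cableColors (c : ℕ → Color) (i x : ℕ) :
    polesBelow (cableColors c i) x =
      if x ≤ i then polesBelow c x
      else polesBelow c (x - 1) + if c i = Color.pole then 1 else 0 := by
  induction x with
  | zero => simp [polesBelow]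
  | succ x ih =>
    rw [polesBelow_succ, ih]
    rcases lt_trichotomy x i with h | rfl | h
    · simp only [cableColors, if_pos h.le, if_pos (show x + 1 ≤ i by omega), polesBelow_succ]
    · simp [cableColors]
    · obtain ⟨y, rfl⟩ : ∃ y, x = y + 1 := ⟨x - 1, by omega⟩
      simp only [cableColors, if_neg (show ¬ y + 1 ≤ i by omega),
        if_neg (show ¬ y + 1 + 1 ≤ i by omega), Nat.add_sub_cancel, polesBelow_succ c y]
      omega

theorem cableColors_permute (c : ℕ → Color) (i : ℕ) (β : BraidInf) :
    cableColors c i ∘ footHom (cable i β) =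
      cableColors (c ∘ footHom β) (strandPerm β i) := by
  ext x
  obtain ⟨y, rfl⟩ := (cablePerm i (strandPerm β)).surjective x
  rw [Function.comp_apply, footHom_cable, Equiv.Perm.inv_def, Equiv.symm_apply_apply, cablePerm_apply]
  simp only [cableColors, footHom_eq, Function.comp_apply]
  split_ifs <;> simp <;> grind

theorem forget_cableVal (c : ℕ → Color) (i k : ℕ) :
    forget (cableColors c i) (cableVal k i) =
      if c i = Color.pole then cable (polesBelow c i) (forgetVal gen k c)
      else forgetVal gen k c := by
  have fm : ∀ (d : ℕ → Color) (j k : ℕ), forget d (gen j * gen k) =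
      forgetVal gen j d * forgetVal gen k (permuteColors j d) := by
    intro d j k
    rw [forget_mul, forget_gen, forget_gen]
    simp [permuteColors]
  have e : k + 1 + 1 = k + 2 := rfl
  rcases lt_trichotomy i k with h | rfl | h
  · rw [cableVal_lt h, forget_gen]
    have a1 : cableColors c i (k + 1) = c k := by simp [cableColors, show ¬ k + 1 ≤ i by omega]
    have a2 : cableColors c i (k + 2) = c (k + 1) := by
      simp [cableColors, show ¬ k + 2 ≤ i by omega]
    simp only [forgetVal, e, a1, a2, polesBelow_cableColors, if_neg (show ¬ k + 1 ≤ i by omega),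
      Nat.add_sub_cancel]
    by_cases hi : c i = Color.pole <;> by_cases hk : c k = Color.pole ∧ c (k + 1) = Color.pole <;>
      simp [hi, hk, cable_one, cable_gen]
    exact (cableVal_lt (Nat.count_strict_mono hi h)).symm
  · rw [cableVal_self, fm]
    have a0 : cableColors c i i = c i := by simp [cableColors]
    have a1 : cableColors c i (i + 1) = c i := by simp [cableColors]
    have a2 : cableColors c i (i + 2) = c (i + 1) := by simp [cableColors]
    have b0 : permuteColors (i + 1) (cableColors c i) i = c i := by
      rw [permuteColors_ne (by omega) (by omega), a0]
    have b1 : permuteColors (i + 1) (cableColors c i) (i + 1) = c (i + 1) := by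
      rw [permuteColors_self, a2]
    simp only [forgetVal, e, a1, a2, b0, b1, polesBelow_permute_le (show i ≤ i + 1 by omega),
      polesBelow_cableColors, if_neg (show ¬ i + 1 ≤ i by omega), Nat.add_sub_cancel]
    by_cases hi : c i = Color.pole <;> by_cases hk : c (i + 1) = Color.pole <;>
      simp [hi, hk, cable_one, cable_gen, cableVal_self]
  · rcases (show i = k + 1 ∨ k + 1 < i by omega) with rfl | h
    · rw [cableVal_succ, fm]
      have a0 : cableColors c (k + 1) k = c k := by simp [cableColors]
      have a1 : cableColors c (k + 1) (k + 1) = c (k + 1) := by simp [cableColors]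
      have a2 : cableColors c (k + 1) (k + 2) = c (k + 1) := by simp [cableColors]
      have b1 : permuteColors k (cableColors c (k + 1)) (k + 1) = c k := by
        rw [permuteColors_succ, a0]
      have b0 : permuteColors k (cableColors c (k + 1)) k = c (k + 1) := by
        rw [permuteColors_self, a1]
      have b2 : permuteColors k (cableColors c (k + 1)) (k + 2) = c (k + 1) := by
        rw [permuteColors_ne (by omega) (by omega), a2]
      simp only [forgetVal, e, a0, a1, b0, b1, b2, polesBelow_succ, polesBelow_permute_le le_rfl,
        polesBelow_cableColors, if_pos (show k ≤ k + 1 by omega)]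
      by_cases hi : c (k + 1) = Color.pole <;> by_cases hk : c k = Color.pole <;>
        simp [hi, hk, cable_one, cable_gen, cableVal_succ]
    · rw [cableVal_gt h, forget_gen]
      have a1 : cableColors c i k = c k := by simp [cableColors, show k ≤ i by omega]
      have a2 : cableColors c i (k + 1) = c (k + 1) := by
        simp [cableColors, show k + 1 ≤ i by omega]
      simp only [forgetVal, a1, a2, polesBelow_cableColors, if_pos (show k ≤ i by omega)]
      by_cases hi : c i = Color.pole <;>
        by_cases hk : c k = Color.pole ∧ c (k + 1) = Color.pole <;>
        simp [hi, hk, cable_one, cable_gen]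
      exact (cableVal_gt (polesBelow_add_two_le h hk.1 hk.2)).symm

theorem forget_cable (c : ℕ → Color) (i : ℕ) (β : BraidInf) :
    forget (cableColors c i) (cable i β) =
      if c i = Color.pole then cable (polesBelow c i) (forget c β) else forget c β := by
  refine cocycle_ext
    (act := fun (p : (ℕ → Color) × ℕ) β => (p.1 ∘ footHom β, strandPerm β p.2))
    (F := fun p β => forget (cableColors p.1 p.2) (cable p.2 β))
    (G := fun p β => if p.1 p.2 = Color.pole then cable (polesBelow p.1 p.2) (forget p.1 β)
      else forget p.1 β)
    ?_ ?_ ?_ ?_ ?_ (c, i) β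
  · rintro ⟨c, i⟩ β γ
    simp only [strandPerm_mul, Equiv.trans_apply, Prod.mk.injEq, and_true]
    ext; simp
  · rintro ⟨c, i⟩; simp [strandPerm]
  · rintro ⟨c, i⟩ β γ
    dsimp only
    rw [cable_mul, forget_mul, cableColors_permute]
  · rintro ⟨c, i⟩ β γ
    dsimp only
    have e : (c ∘ footHom β) (strandPerm β i) = c i := by simp [strandPerm]
    simp only [e, forget_mul]
    split_ifs with h
    · rw [cable_mul, forget_perm c i h]
    · rfl
  · rintro ⟨c, i⟩ k
    dsimp only
    simp only [cable_gen, forget_gen]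
    exact forget_cableVal c i k

/-- The coloring after making position `i` blue. -/
def recolor (c : ℕ → Color) (i : ℕ) : ℕ → Color := Function.update c i Color.strand

theorem recolor_of_strand {c : ℕ → Color} {i : ℕ} (h : c i ≠ Color.pole) : recolor c i = c := by
  have : c i = Color.strand := by cases hc : c i <;> simp_all
  rw [recolor, ← this, Function.update_eq_self]

theorem polesBelow_recolor (c : ℕ → Color) (i n : ℕ) (hi : c i = Color.pole) :
    polesBelow (recolor c i) n + (if i < n then 1 else 0) = polesBelow c n := by
  induction n with
  | zero => simp [polesBelow]
  | succ n ih =>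
    rw [polesBelow_succ, polesBelow_succ, ← ih]
    rcases lt_trichotomy i n with h | rfl | h
    · simp [recolor, h.ne', h, show i < n + 1 by omega]; omega
    · simp [recolor, hi]
    · simp [recolor, h.ne, show ¬ i < n by omega, show ¬ i < n + 1 by omega]

theorem polesBelow_all (n : ℕ) : polesBelow (fun _ => Color.pole) n = n := by
  induction n with
  | zero => rfl
  | succ n ih => rw [polesBelow_succ, ih]; simp

theorem recolor_permute (c : ℕ → Color) (i : ℕ) (β : BraidInf) :
    recolor c i ∘ footHom β = recolor (c ∘ footHom β) (strandPerm β i) := by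
  ext x
  obtain ⟨y, rfl⟩ := (strandPerm β).surjective x
  simp only [recolor, Function.comp_apply, Function.update_apply, EmbeddingLike.apply_eq_iff_eq,
    footHom_eq, Equiv.Perm.inv_def, Equiv.symm_apply_apply]

theorem forgetVal_recolor (c : ℕ → Color) (i k : ℕ) (hi : c i = Color.pole) :
    forgetVal gen k (recolor c i) =
      forget (recolor (fun _ => Color.pole) (polesBelow c i)) (forgetVal gen k c) := by
  have hk := polesBelow_recolor c i k hi
  by_cases h : c k = Color.pole ∧ c (k + 1) = Color.pole
  · have hv : forgetVal gen k c = gen (polesBelow c k) := if_pos h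
    have hr := polesBelow_recolor (fun _ => Color.pole) (polesBelow c i) (polesBelow c k) rfl
    rw [polesBelow_all] at hr
    rw [hv, forget_gen]
    rcases lt_trichotomy i k with hik | rfl | hik
    · have : polesBelow c i < polesBelow c k := Nat.count_strict_mono hi hik
      rw [if_pos this] at hr
      rw [if_pos hik] at hk
      simp only [forgetVal, recolor, Function.update_apply]
      rw [if_neg (show k ≠ i by omega), if_neg (show k + 1 ≠ i by omega), if_pos h,
        if_neg (show polesBelow c k ≠ polesBelow c i by omega),
        if_neg (show polesBelow c k + 1 ≠ polesBelow c i by omega), if_pos ⟨rfl, rfl⟩]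
      congr 1
      simp only [recolor] at hk hr
      omega
    · simp [forgetVal, recolor]
    · rcases (show i = k + 1 ∨ k + 1 < i by omega) with rfl | hik'
      · simp [forgetVal, recolor, polesBelow_succ, h.1]
      · have := polesBelow_add_two_le (k := i) hik' h.1 h.2
        rw [if_neg (by omega)] at hr
        rw [if_neg (by omega)] at hk
        simp only [forgetVal, recolor, Function.update_apply]
        rw [if_neg (show k ≠ i by omega), if_neg (show k + 1 ≠ i by omega), if_pos h,
          if_neg (show polesBelow c k ≠ polesBelow c i by omega),
          if_neg (show polesBelow c k + 1 ≠ polesBelow c i by omega), if_pos ⟨rfl, rfl⟩]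
        congr 1
        simp only [recolor] at hk hr
        omega
  · have hv : forgetVal gen k c = 1 := if_neg h
    rw [hv, forget_one, forgetVal, if_neg]
    intro h'
    apply h
    simp only [recolor, Function.update_apply] at h'
    grind

theorem forget_recolor (c : ℕ → Color) (i : ℕ) (β : BraidInf) :
    forget (recolor c i) β =
      if c i = Color.pole then
        forget (recolor (fun _ => Color.pole) (polesBelow c i)) (forget c β)
      else forget c β := by
  refine cocycle_ext
    (act := fun (p : (ℕ → Color) × ℕ) β => (p.1 ∘ footHom β, strandPerm β p.2))
    (F := fun p β => forget (recolor p.1 p.2) β)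
    (G := fun p β => if p.1 p.2 = Color.pole then
        forget (recolor (fun _ => Color.pole) (polesBelow p.1 p.2)) (forget p.1 β)
      else forget p.1 β)
    ?_ ?_ ?_ ?_ ?_ (c, i) β
  · rintro ⟨c, i⟩ β γ
    simp only [strandPerm_mul, Equiv.trans_apply, Prod.mk.injEq, and_true]
    ext; simp
  · rintro ⟨c, i⟩; simp [strandPerm]
  · rintro ⟨c, i⟩ β γ
    dsimp only
    rw [forget_mul, recolor_permute]
  · rintro ⟨c, i⟩ β γ
    dsimp only
    have e : (c ∘ footHom β) (strandPerm β i) = c i := by simp [strandPerm]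
    simp only [e, forget_mul]
    split_ifs with h
    · rw [recolor_permute, forget_perm c i h]; rfl
    · rfl
  · rintro ⟨c, i⟩ k
    simp only [forget_gen]
    split_ifs with h
    · exact forgetVal_recolor c i k h
    · rw [recolor_of_strand h]

theorem polesBelow_shiftColors (d : Color) (c : ℕ → Color) (n : ℕ) :
    polesBelow (shiftColors d c) (n + 1) =
      polesBelow c n + if d = Color.pole then 1 else 0 := by
  induction n with
  | zero => rw [polesBelow_succ]; rfl
  | succ n ih =>
    rw [polesBelow_succ, ih, polesBelow_succ, show shiftColors d c (n + 1) = c n from rfl]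
    omega

theorem shiftColors_permute (d : Color) (c : ℕ → Color) (β : BraidInf) :
    shiftColors d c ∘ footHom (shift β) = shiftColors d (c ∘ footHom β) := by
  ext x
  obtain ⟨y, rfl⟩ := (shiftPerm (strandPerm β)).surjective x
  rw [Function.comp_apply, footHom_eq, strandPerm_shift, Equiv.Perm.inv_def,
    Equiv.symm_apply_apply]
  cases y <;> simp [shiftColors, strandPerm]

theorem forget_shift (d : Color) (c : ℕ → Color) (β : BraidInf) :
    forget (shiftColors d c) (shift β) =
      if d = Color.pole then shift (forget c β) else forget c β := by
  refine cocycle_ext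
    (act := fun (c : ℕ → Color) β => c ∘ footHom β)
    (F := fun c β => forget (shiftColors d c) (shift β))
    (G := fun c β => if d = Color.pole then shift (forget c β) else forget c β)
    ?_ ?_ ?_ ?_ ?_ c β
  · intro c β γ; ext; simp
  · intro c; simp
  · intro c β γ
    rw [map_mul, forget_mul, shiftColors_permute]
  · intro c β γ
    simp only [forget_mul]
    split_ifs <;> simp
  · intro c k
    simp only [shift_gen, forget_gen, forgetVal, polesBelow_shiftColors]
    have e1 : shiftColors d c (k + 1) = c k := rfl
    have e2 : shiftColors d c (k + 1 + 1) = c (k + 1) := rfl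
    rw [e1, e2]
    by_cases h : c k = Color.pole ∧ c (k + 1) = Color.pole <;> by_cases hd : d = Color.pole <;>
      simp [h, hd]

theorem gen_mem {l k : ℕ} (h : k + 1 < l) : gen k ∈ braidSubgroup l :=
  Subgroup.subset_closure ⟨k, h, rfl⟩

theorem strandPerm_inv (β : BraidInf) : strandPerm β⁻¹ = (strandPerm β)⁻¹ := by
  simp [strandPerm]

theorem strandPerm_of_le {l : ℕ} {β : BraidInf} (hβ : β ∈ braidSubgroup l) {i : ℕ} (hi : l ≤ i) :
    strandPerm β i = i := by
  induction hβ using Subgroup.closure_induction with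
  | mem x hx => obtain ⟨k, hk, rfl⟩ := hx; rw [strandPerm_gen]; exact swap_gt (by omega)
  | one => simp [strandPerm]
  | mul x y _ _ hx hy => rw [strandPerm_mul, Equiv.trans_apply, hx, hy]
  | inv x _ hx => rw [strandPerm_inv, Equiv.Perm.inv_eq_iff_eq, hx]

theorem strandPerm_lt {l : ℕ} {β : BraidInf} (hβ : β ∈ braidSubgroup l) {i : ℕ} (hi : i < l) :
    strandPerm β i < l := by
  by_contra h
  have := strandPerm_of_le hβ (not_lt.mp h)
  have := (strandPerm β).injective this
  omega

theorem cable_inv (i : ℕ) (β : BraidInf) :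
    cable i β⁻¹ = (cable (strandPerm β⁻¹ i) β)⁻¹ := by
  have m := cable_mul i β⁻¹ β
  rw [inv_mul_cancel, cable_one] at m
  exact eq_inv_of_mul_eq_one_left m.symm

theorem forget_inv (c : ℕ → Color) (β : BraidInf) :
    forget c β⁻¹ = (forget (c ∘ footHom β⁻¹) β)⁻¹ := by
  have m := forget_mul c β⁻¹ β
  rw [inv_mul_cancel, forget_one] at m
  exact eq_inv_of_mul_eq_one_left m.symm

theorem cable_mem {l : ℕ} {β : BraidInf} (hβ : β ∈ braidSubgroup l) (i : ℕ) :
    cable i β ∈ braidSubgroup (l + 1) := by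
  induction hβ using Subgroup.closure_induction generalizing i with
  | mem x hx =>
    obtain ⟨k, hk, rfl⟩ := hx
    have h1 : gen k ∈ braidSubgroup (l + 1) := gen_mem (by omega)
    have h2 : gen (k + 1) ∈ braidSubgroup (l + 1) := gen_mem (by omega)
    rw [cable_gen, cableVal]
    split_ifs
    · exact h2
    · exact mul_mem h2 h1
    · exact mul_mem h1 h2
    · exact h1
  | one => rw [cable_one]; exact one_mem _
  | mul x y _ _ hx hy => rw [cable_mul]; exact mul_mem (hx _) (hy _)
  | inv x _ hx => rw [cable_inv]; exact inv_mem (hx _)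

theorem shift_mem {l : ℕ} {β : BraidInf} (hβ : β ∈ braidSubgroup l) :
    shift β ∈ braidSubgroup (l + 1) := by
  induction hβ using Subgroup.closure_induction with
  | mem x hx => obtain ⟨k, hk, rfl⟩ := hx; rw [shift_gen]; exact gen_mem (by omega)
  | one => rw [map_one]; exact one_mem _
  | mul x y _ _ hx hy => rw [map_mul]; exact mul_mem hx hy
  | inv x _ hx => rw [map_inv]; exact inv_mem hx

theorem braidSubgroup_mono {l l' : ℕ} (h : l ≤ l') : braidSubgroup l ≤ braidSubgroup l' :=
  Subgroup.closure_mono fun _ ⟨k, hk, e⟩ => ⟨k, by omega, e⟩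

theorem forget_congr {l : ℕ} {β : BraidInf} (hβ : β ∈ braidSubgroup l) {c c' : ℕ → Color}
    (h : ∀ i < l, c i = c' i) : forget c β = forget c' β := by
  have key : ∀ {β : BraidInf}, β ∈ braidSubgroup l → ∀ {c c' : ℕ → Color},
      (∀ i < l, c i = c' i) → ∀ i < l, (c ∘ footHom β) i = (c' ∘ footHom β) i := by
    intro β hβ c c' h i hi
    refine h _ ?_
    have := strandPerm_lt (inv_mem hβ) hi
    rwa [strandPerm_inv, ← footHom_eq] at this
  induction hβ using Subgroup.closure_induction generalizing c c' with
  | mem x hx =>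
    obtain ⟨k, hk, rfl⟩ := hx
    rw [forget_gen, forget_gen, forgetVal, forgetVal, h k (by omega), h (k + 1) (by omega),
      polesBelow_congr fun i hi => h i (by omega)]
  | one => rw [forget_one, forget_one]
  | mul x y hx hy ihx ihy =>
    rw [forget_mul, forget_mul, ihx h, ihy (key hx h)]
  | inv x hx ih =>
    rw [forget_inv, forget_inv, ih (key (inv_mem hx) h)]

/-- The color of the `i`-th letter of the word `o` (blue beyond the end, where nothing happens). -/
def colorAt (o : List Color) (i : ℕ) : Color := o.getD i Color.strand

/-- `σ` is a mixed permutation from `o` to `o'`: it permutes the positions `0, …, l - 1`, where `l`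
is the length of both words, it respects the colors, and it keeps the order of the poles, that is, it
becomes the trivial permutation when the blue letters are forgotten. -/
structure IsMixedPerm (o o' : List Color) (σ : Equiv.Perm ℕ) : Prop where
  length_eq : o'.length = o.length
  fix : ∀ i, o.length ≤ i → σ i = i
  color : ∀ i, colorAt o' (σ i) = colorAt o i
  mono : ∀ i j, colorAt o i = Color.pole → colorAt o j = Color.pole → i < j → σ i < σ j

/-- `β` is a mixed braid from `o` (bottom) to `o'` (top): a braid on `l` strands, where `l` is the
length of both words, whose strands join equal colors, and which becomes the trivial braid when the
blue strands are forgotten. (A braid is trivial in `B_∞` if and only if it is trivial in `B_m`, by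
`toInf_injective`.) -/
structure IsMixedBraid (o o' : List Color) (β : BraidInf) : Prop where
  mem : β ∈ braidSubgroup o.length
  length_eq : o'.length = o.length
  color : ∀ i, colorAt o' (strandPerm β i) = colorAt o i
  forget_eq : forget (colorAt o) β = 1

/-- A morphism from `o` to `o'` in the category **MB** of mixed braids: a pair of a mixed
permutation and a `ℚ`-linear combination of mixed braids with this underlying permutation. -/
@[ext]
structure MBHom (o o' : List Color) where
  perm : Equiv.Perm ℕ
  isMixedPerm : IsMixedPerm o o' perm
  comb : MonoidAlgebra ℚ BraidInf
  isMixedBraid : ∀ β ∈ comb.coeff.support, IsMixedBraid o o' β ∧ strandPerm β = perm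

theorem IsMixedPerm.refl (o : List Color) : IsMixedPerm o o (Equiv.refl ℕ) where
  length_eq := rfl
  fix _ _ := rfl
  color _ := rfl
  mono _ _ _ _ h := h

theorem IsMixedPerm.trans {o o' o'' : List Color} {σ τ : Equiv.Perm ℕ} (h : IsMixedPerm o o' σ)
    (h' : IsMixedPerm o' o'' τ) : IsMixedPerm o o'' (σ.trans τ) where
  length_eq := h'.length_eq.trans h.length_eq
  fix i hi := by
    rw [Equiv.trans_apply, h.fix i hi, h'.fix i (by rwa [h.length_eq])]
  color i := by rw [Equiv.trans_apply, h'.color, h.color]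
  mono i j hi hj hij :=
    h'.mono _ _ (by rw [h.color, hi]) (by rw [h.color, hj]) (h.mono i j hi hj hij)

theorem IsMixedBraid.one (o : List Color) : IsMixedBraid o o 1 where
  mem := one_mem _
  length_eq := rfl
  color _ := by simp [strandPerm]
  forget_eq := forget_one _

theorem colorAt_comp {o o' : List Color} {β : BraidInf}
    (h : ∀ i, colorAt o' (strandPerm β i) = colorAt o i) :
    colorAt o ∘ footHom β = colorAt o' := by
  ext i
  rw [Function.comp_apply, ← h]
  simp [strandPerm]

theorem IsMixedBraid.mul {o o' o'' : List Color} {β γ : BraidInf} (h : IsMixedBraid o o' β)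
    (h' : IsMixedBraid o' o'' γ) : IsMixedBraid o o'' (β * γ) where
  mem := mul_mem h.mem (h.length_eq ▸ h'.mem)
  length_eq := h'.length_eq.trans h.length_eq
  color i := by rw [strandPerm_mul, Equiv.trans_apply, h'.color, h.color]
  forget_eq := by
    rw [forget_mul, colorAt_comp h.color, h.forget_eq, h'.forget_eq, one_mul]

theorem exists_of_mem_support_mul {x y : MonoidAlgebra ℚ BraidInf} {β : BraidInf}
    (h : β ∈ (x * y).coeff.support) :
    ∃ β₁ ∈ x.coeff.support, ∃ β₂ ∈ y.coeff.support, β₁ * β₂ = β := by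
  classical
  exact Finset.mem_mul.mp (MonoidAlgebra.support_coeff_mul_subset x y h)

theorem exists_of_mem_support_mapDomain {f : BraidInf → BraidInf} {x : MonoidAlgebra ℚ BraidInf}
    {β : BraidInf} (h : β ∈ (x.mapDomain f).coeff.support) :
    ∃ γ ∈ x.coeff.support, f γ = β := by
  classical
  exact Finset.mem_image.mp (Finsupp.mapDomain_support h)

theorem eq_of_mem_support_single {β γ : BraidInf} {q : ℚ}
    (h : β ∈ (MonoidAlgebra.single γ q).coeff.support) : β = γ :=
  Finset.mem_singleton.mp (Finsupp.support_single_subset h)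

/-- The identity morphism: the trivial braid. -/
noncomputable def MBHom.id (o : List Color) : MBHom o o where
  perm := Equiv.refl ℕ
  isMixedPerm := .refl o
  comb := 1
  isMixedBraid β h := by
    obtain rfl := eq_of_mem_support_single h
    exact ⟨.one o, by ext; simp [strandPerm]⟩

/-- Composition: the bilinear extension of the product of braids, in the group algebra. -/
noncomputable def MBHom.comp {o o' o'' : List Color} (f : MBHom o o') (g : MBHom o' o'') :
    MBHom o o'' where
  perm := f.perm.trans g.perm
  isMixedPerm := f.isMixedPerm.trans g.isMixedPerm
  comb := f.comb * g.comb
  isMixedBraid β h := by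
    obtain ⟨β₁, h₁, β₂, h₂, rfl⟩ := exists_of_mem_support_mul h
    have h₁ := f.isMixedBraid β₁ h₁
    have h₂ := g.isMixedBraid β₂ h₂
    exact ⟨h₁.1.mul h₂.1, by rw [strandPerm_mul, h₁.2, h₂.2]⟩

/-- Parenthesized words in the two letters pole and strand, including the empty word `1`. The
product `O * O'` is `(O)(O')`, and the empty word is its unit. -/
abbrev Par : Type := WithOne (FreeMagma Color)

namespace Par

/-- The word with one letter. -/
def letter (c : Color) : Par := (FreeMagma.of c : FreeMagma Color)

/-- Forgetting the parenthesization of a nonempty parenthesized word. -/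
def treeWord : FreeMagma Color → List Color
  | .of c => [c]
  | .mul a b => treeWord a ++ treeWord b

/-- Forgetting the parenthesization. -/
def word (O : Par) : List Color := WithOne.recOneCoe [] treeWord O

/-- Forgetting the blue letters of a nonempty parenthesized word. -/
def treeSkeleton : FreeMagma Color → Par
  | .of Color.pole => letter Color.pole
  | .of Color.strand => 1
  | .mul a b => treeSkeleton a * treeSkeleton b

/-- The parenthesized word in poles only that is obtained by forgetting the blue letters. -/
def skeleton (O : Par) : Par := WithOne.recOneCoe 1 treeSkeleton O

/-- Replacing the letter `c` at position `i` by `F c`. -/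
def treeReplace (F : Color → FreeMagma Color) : FreeMagma Color → ℕ → FreeMagma Color
  | .of c, 0 => F c
  | .of c, _ + 1 => .of c
  | .mul a b, i =>
    if i < (treeWord a).length then .mul (treeReplace F a i) b
    else .mul a (treeReplace F b (i - (treeWord a).length))

/-- Replacing the letter `c` at position `i` by the parenthesized word `F c`. -/
def replace (F : Color → FreeMagma Color) (O : Par) (i : ℕ) : Par :=
  WithOne.recOneCoe 1 (fun t => (treeReplace F t i : FreeMagma Color)) O

/-- Replacing the letter `c` at position `i` by `(c c)`. -/
def double (O : Par) (i : ℕ) : Par := O.replace (fun c => .mul (.of c) (.of c)) i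

/-- Changing the letter at position `i` to a strand. -/
def toStrand (O : Par) (i : ℕ) : Par := O.replace (fun _ => .of Color.strand) i

end Par

/-- A morphism in the category **PaMB** of parenthesized mixed braids: a morphism in **MB** between
the underlying words, which exists only if the two parenthesized words of poles agree. -/
@[ext]
structure PaMBHom (O O' : Par) extends MBHom O.word O'.word where
  skeleton_eq : O.skeleton = O'.skeleton

/-- The category **PaMB** of parenthesized mixed braids. In `f ≫ g` the morphism `g` is on top. -/
noncomputable instance : Category Par where
  Hom := PaMBHom
  id O := { MBHom.id O.word with skeleton_eq := rfl }
  comp f g := { f.toMBHom.comp g.toMBHom with skeleton_eq := f.skeleton_eq.trans g.skeleton_eq }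
  id_comp f := by
    apply PaMBHom.ext
    · ext; rfl
    · exact one_mul _
  comp_id f := by
    apply PaMBHom.ext
    · ext; rfl
    · exact mul_one _
  assoc f g h := by
    apply PaMBHom.ext
    · ext; rfl
    · exact mul_assoc _ _ _

namespace Par

theorem word_mul (O O' : Par) : (O * O').word = O.word ++ O'.word := by
  induction O using WithOne.recOneCoe with
  | one => simp [word]
  | coe a =>
    induction O' using WithOne.recOneCoe with
    | one => simp [word]
    | coe b => rfl

theorem skeleton_mul (O O' : Par) : (O * O').skeleton = O.skeleton * O'.skeleton := by
  induction O using WithOne.recOneCoe with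
  | one => simp [skeleton]
  | coe a =>
    induction O' using WithOne.recOneCoe with
    | one => simp [skeleton]
    | coe b => rfl

theorem word_letter (c : Color) : (letter c).word = [c] := rfl

end Par

theorem colorAt_cons (d : Color) (o : List Color) : colorAt (d :: o) = shiftColors d (colorAt o) := by
  ext i
  cases i <;> simp [colorAt, shiftColors]

theorem colorAt_append_left {o o' : List Color} {i : ℕ} (h : i < o.length) :
    colorAt (o ++ o') i = colorAt o i := by
  simp [colorAt, List.getElem?_append_left h]

theorem colorAt_append_right {o o' : List Color} {i : ℕ} (h : o.length ≤ i) :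
    colorAt (o ++ o') i = colorAt o' (i - o.length) := by
  simp [colorAt, List.getElem?_append_right h]

theorem colorAt_of_le {o : List Color} {i : ℕ} (h : o.length ≤ i) :
    colorAt o i = Color.strand := by
  simp [colorAt, h]

theorem lt_of_colorAt {o : List Color} {i : ℕ} (h : colorAt o i = Color.pole) : i < o.length := by
  by_contra h'
  rw [colorAt_of_le (not_lt.mp h')] at h
  cases h

/-- Replacing the letter `c` at position `i` of a word by the word `F c`. -/
def wordReplace (F : Color → List Color) : List Color → ℕ → List Color
  | [], _ => []
  | c :: o, 0 => F c ++ o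
  | c :: o, i + 1 => c :: wordReplace F o i

theorem wordReplace_append (F : Color → List Color) (o o' : List Color) (i : ℕ) :
    wordReplace F (o ++ o') i =
      if i < o.length then wordReplace F o i ++ o' else o ++ wordReplace F o' (i - o.length) := by
  induction o generalizing i with
  | nil => simp
  | cons c o ih =>
    cases i with
    | zero => simp [wordReplace]
    | succ i =>
      simp only [List.cons_append, wordReplace, ih, List.length_cons, Nat.add_lt_add_iff_right,
        Nat.add_sub_add_right]
      split_ifs <;> rfl

namespace Par

theorem treeWord_replace (F : Color → FreeMagma Color) (t : FreeMagma Color) (i : ℕ) :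
    treeWord (treeReplace F t i) = wordReplace (fun c => treeWord (F c)) (treeWord t) i := by
  induction t using FreeMagma.rec generalizing i with
  | of c => cases i <;> simp [treeReplace, treeWord, wordReplace]
  | mul a b iha ihb =>
    simp only [treeReplace, treeWord, wordReplace_append]
    split_ifs <;> simp [treeWord, iha, ihb]

theorem word_replace (F : Color → FreeMagma Color) (O : Par) (i : ℕ) :
    (O.replace F i).word = wordReplace (fun c => treeWord (F c)) O.word i := by
  induction O using WithOne.recOneCoe with
  | one => rfl
  | coe t => exact treeWord_replace F t i

end Par

theorem wordDouble {o : List Color} {i : ℕ} (h : i < o.length) :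
    colorAt (wordReplace (fun c => [c, c]) o i) = cableColors (colorAt o) i := by
  induction o generalizing i with
  | nil => simp at h
  | cons c o ih =>
    ext x
    cases i with
    | zero =>
      simp only [wordReplace, List.cons_append, List.nil_append, colorAt_cons, cableColors]
      rcases x with _ | _ | x <;> simp [shiftColors]
    | succ i =>
      rw [wordReplace, colorAt_cons, colorAt_cons, ih (by simpa using h)]
      rcases x with _ | x
      · simp [shiftColors, cableColors]
      · simp only [shiftColors, cableColors]
        rcases x with _ | x
        · simp
        · by_cases hx : x + 1 ≤ i
          · simp [hx]
          · simp [hx]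

theorem length_wordDouble {o : List Color} {i : ℕ} (h : i < o.length) :
    (wordReplace (fun c => [c, c]) o i).length = o.length + 1 := by
  induction o generalizing i with
  | nil => simp at h
  | cons c o ih =>
    cases i with
    | zero => simp [wordReplace]
    | succ i => simp [wordReplace, ih (show i < o.length by simpa using h)]

theorem wordToStrand (o : List Color) (i : ℕ) :
    colorAt (wordReplace (fun _ => [Color.strand]) o i) = recolor (colorAt o) i := by
  induction o generalizing i with
  | nil => rw [recolor_of_strand (by simp [colorAt])]; rfl
  | cons c o ih =>
    ext x
    cases i with
    | zero =>
      simp only [wordReplace, List.cons_append, List.nil_append, colorAt_cons]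
      cases x <;> simp [shiftColors, recolor]
    | succ i =>
      rw [wordReplace, colorAt_cons, colorAt_cons, ih]
      cases x <;> simp [shiftColors, recolor, Function.update_apply]

theorem length_wordToStrand (o : List Color) (i : ℕ) :
    (wordReplace (fun _ => [Color.strand]) o i).length = o.length := by
  induction o generalizing i with
  | nil => rfl
  | cons c o ih => cases i <;> simp [wordReplace, ih]

namespace IsMixedPerm

variable {o o' : List Color} {σ : Equiv.Perm ℕ}

theorem lt (h : IsMixedPerm o o' σ) {i : ℕ} (hi : i < o.length) : σ i < o.length := by
  by_contra h'
  have := σ.injective (h.fix _ (not_lt.mp h'))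
  omega

theorem pole_lt_iff (h : IsMixedPerm o o' σ) {i j : ℕ} (hi : colorAt o i = Color.pole)
    (hj : colorAt o j = Color.pole) : σ i < σ j ↔ i < j := by
  refine ⟨fun hij => ?_, h.mono i j hi hj⟩
  by_contra hn
  rcases (not_lt.mp hn).lt_or_eq with h' | rfl
  · exact absurd (h.mono j i hj hi h') (by omega)
  · omega

theorem polesBelow_eq (h : IsMixedPerm o o' σ) {i : ℕ} (hi : colorAt o i = Color.pole) :
    polesBelow (colorAt o') (σ i) = polesBelow (colorAt o) i := by
  rw [polesBelow, polesBelow, Nat.count_eq_card_filter_range, Nat.count_eq_card_filter_range]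
  symm
  refine Finset.card_bij (fun j _ => σ j) ?_ (fun a _ b _ e => σ.injective e) ?_
  · intro j hj
    simp only [Finset.mem_filter, Finset.mem_range] at hj ⊢
    exact ⟨h.mono j i hj.2 hi hj.1, by rw [h.color, hj.2]⟩
  · intro j hj
    simp only [Finset.mem_filter, Finset.mem_range] at hj
    have hc : colorAt o (σ.symm j) = Color.pole := by
      rw [← h.color, Equiv.apply_symm_apply, hj.2]
    refine ⟨σ.symm j, ?_, by simp⟩
    simp only [Finset.mem_filter, Finset.mem_range]
    exact ⟨(h.pole_lt_iff hc hi).mp (by simpa using hj.1), hc⟩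

theorem cons (h : IsMixedPerm o o' σ) (d : Color) :
    IsMixedPerm (d :: o) (d :: o') (shiftPerm σ) where
  length_eq := by simp [h.length_eq]
  fix i hi := by
    cases i with
    | zero => simp at hi
    | succ i => rw [shiftPerm_succ, h.fix i (by simpa using hi)]
  color i := by
    rw [colorAt_cons, colorAt_cons]
    cases i with
    | zero => rfl
    | succ i => exact h.color i
  mono i j hi hj hij := by
    rw [colorAt_cons] at hi hj
    cases j with
    | zero => omega
    | succ j =>
      cases i with
      | zero => simp
      | succ i =>
        rw [shiftPerm_succ, shiftPerm_succ]
        have := h.mono i j hi hj (by omega)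
        omega

theorem append (h : IsMixedPerm o o' σ) (d : Color) : IsMixedPerm (o ++ [d]) (o' ++ [d]) σ where
  length_eq := by simp [h.length_eq]
  fix i hi := h.fix i (by simp at hi; omega)
  color i := by
    by_cases hi : i < o.length
    · have := h.lt hi
      rw [colorAt_append_left hi, colorAt_append_left (by rwa [h.length_eq]), h.color]
    · have hi := not_lt.mp hi
      rw [h.fix i hi, colorAt_append_right hi, colorAt_append_right (by rwa [h.length_eq]),
        h.length_eq]
  mono i j hi hj hij := by
    have hj' := lt_of_colorAt hj
    rw [List.length_append, List.length_singleton] at hj'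
    have hi' : i < o.length := by omega
    rw [colorAt_append_left hi'] at hi
    by_cases hj'' : j < o.length
    · rw [colorAt_append_left hj''] at hj
      exact h.mono i j hi hj hij
    · rw [h.fix j (not_lt.mp hj'')]
      have := h.lt hi'
      omega

theorem double (h : IsMixedPerm o o' σ) {i : ℕ} (hi : i < o.length) :
    IsMixedPerm (wordReplace (fun c => [c, c]) o i) (wordReplace (fun c => [c, c]) o' (σ i))
      (cablePerm i σ) where
  length_eq := by
    rw [length_wordDouble hi, length_wordDouble (by rw [h.length_eq]; exact h.lt hi), h.length_eq]
  fix x hx := by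
    rw [length_wordDouble hi] at hx
    have := h.lt hi
    rw [cablePerm_apply, if_neg (by omega), if_neg (show ¬ x ≤ i by omega),
      h.fix (x - 1) (by omega), if_neg (by omega)]
    omega
  color x := by
    rw [wordDouble hi, wordDouble (by rw [h.length_eq]; exact h.lt hi), cablePerm_apply]
    simp only [cableColors]
    rw [← h.color]
    congr 1
    split_ifs <;> grind
  mono x y hx hy hxy := by
    rw [wordDouble hi] at hx hy
    simp only [cableColors] at hx hy
    have m1 := h.mono _ _ hx hy
    rw [cablePerm_apply, cablePerm_apply]
    have inj := σ.injective
    by_cases hx1 : x ≤ i <;> by_cases hy1 : y ≤ i <;>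
      simp only [hx1, hy1, if_true, if_false] at hx hy m1 ⊢
    · have := m1 hxy
      split_ifs <;> omega
    · rcases (show y = i + 1 ∨ i < y - 1 by omega) with rfl | h2
      · simp only [Nat.add_sub_cancel] at m1
        rcases hx1.lt_or_eq with h3 | rfl
        · have := m1 h3
          split_ifs <;> omega
        · split_ifs <;> omega
      · have := m1 (by omega)
        split_ifs <;> omega
    · omega
    · have := m1 (by omega)
      rcases (show x = i + 1 ∨ i < x - 1 by omega) with rfl | h2
      · simp only [Nat.add_sub_cancel] at this
        split_ifs <;> omega
      · have hne : σ (x - 1) ≠ σ i := fun e => by have := inj e; omega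
        split_ifs <;> omega

theorem toStrand (h : IsMixedPerm o o' σ) (i : ℕ) :
    IsMixedPerm (wordReplace (fun _ => [Color.strand]) o i)
      (wordReplace (fun _ => [Color.strand]) o' (σ i)) σ where
  length_eq := by rw [length_wordToStrand, length_wordToStrand, h.length_eq]
  fix x hx := h.fix x (by rwa [length_wordToStrand] at hx)
  color x := by
    rw [wordToStrand, wordToStrand]
    simp only [recolor, Function.update_apply, EmbeddingLike.apply_eq_iff_eq, h.color]
  mono x y hx hy hxy := by
    rw [wordToStrand] at hx hy
    simp only [recolor, Function.update_apply] at hx hy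
    split_ifs at hx hy
    exact h.mono x y hx hy hxy

end IsMixedPerm

namespace IsMixedBraid

variable {o o' : List Color} {β : BraidInf}

theorem cons (h : IsMixedBraid o o' β) (d : Color) :
    IsMixedBraid (d :: o) (d :: o') (shift β) where
  mem := shift_mem h.mem
  length_eq := by simp [h.length_eq]
  color i := by
    rw [colorAt_cons, colorAt_cons, strandPerm_shift]
    cases i with
    | zero => rfl
    | succ i => exact h.color i
  forget_eq := by
    rw [colorAt_cons, forget_shift, h.forget_eq, map_one, ite_self]

theorem append (h : IsMixedBraid o o' β) (d : Color) : IsMixedBraid (o ++ [d]) (o' ++ [d]) β where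
  mem := braidSubgroup_mono (by simp) h.mem
  length_eq := by simp [h.length_eq]
  color i := by
    by_cases hi : i < o.length
    · have := strandPerm_lt h.mem hi
      rw [colorAt_append_left hi, colorAt_append_left (by rwa [h.length_eq]), h.color]
    · have hi := not_lt.mp hi
      rw [strandPerm_of_le h.mem hi, colorAt_append_right hi,
        colorAt_append_right (by rwa [h.length_eq]), h.length_eq]
  forget_eq := by
    rw [forget_congr h.mem fun i hi => colorAt_append_left hi, h.forget_eq]

theorem double (h : IsMixedBraid o o' β) {i : ℕ} (hi : i < o.length) :
    IsMixedBraid (wordReplace (fun c => [c, c]) o i)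
      (wordReplace (fun c => [c, c]) o' (strandPerm β i)) (cable i β) where
  mem := by rw [length_wordDouble hi]; exact cable_mem h.mem i
  length_eq := by
    rw [length_wordDouble hi, length_wordDouble (by rw [h.length_eq]; exact strandPerm_lt h.mem hi),
      h.length_eq]
  color x := by
    rw [wordDouble hi, wordDouble (by rw [h.length_eq]; exact strandPerm_lt h.mem hi),
      ← colorAt_comp h.color, ← cableColors_permute]
    simp [strandPerm]
  forget_eq := by
    rw [wordDouble hi, forget_cable, h.forget_eq, cable_one, ite_self]

theorem toStrand (h : IsMixedBraid o o' β) (i : ℕ) :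
    IsMixedBraid (wordReplace (fun _ => [Color.strand]) o i)
      (wordReplace (fun _ => [Color.strand]) o' (strandPerm β i)) β where
  mem := by rw [length_wordToStrand]; exact h.mem
  length_eq := by rw [length_wordToStrand, length_wordToStrand, h.length_eq]
  color x := by
    rw [wordToStrand, wordToStrand, ← colorAt_comp h.color, ← recolor_permute]
    simp [strandPerm]
  forget_eq := by
    rw [wordToStrand, forget_recolor, h.forget_eq, forget_one, ite_self]

end IsMixedBraid

/-- The number of poles of a word. -/
def numPoles (o : List Color) : ℕ := polesBelow (colorAt o) o.length

theorem polesBelow_append_left {o o' : List Color} {i : ℕ} (h : i ≤ o.length) :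
    polesBelow (colorAt (o ++ o')) i = polesBelow (colorAt o) i :=
  polesBelow_congr fun _ hj => colorAt_append_left (by omega)

theorem polesBelow_append_right (o o' : List Color) (i : ℕ) :
    polesBelow (colorAt (o ++ o')) (o.length + i) = numPoles o + polesBelow (colorAt o') i := by
  induction i with
  | zero => exact polesBelow_append_left le_rfl
  | succ i ih =>
    rw [← add_assoc, polesBelow_succ, ih, polesBelow_succ, colorAt_append_right (by omega),
      Nat.add_sub_cancel_left]
    omega

namespace Par

/-- Replacing the `j`-th pole of a nonempty parenthesized word by `u`. -/
def treeSubst (u : Par) : FreeMagma Color → ℕ → Par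
  | .of Color.pole, 0 => u
  | .of c, _ => letter c
  | .mul a b, j =>
    if j < numPoles (treeWord a) then treeSubst u a j * (b : FreeMagma Color)
    else (a : FreeMagma Color) * treeSubst u b (j - numPoles (treeWord a))

/-- Replacing the `j`-th pole by `u`. -/
def subst (u O : Par) (j : ℕ) : Par := WithOne.recOneCoe 1 (fun t => treeSubst u t j) O

theorem subst_mul (u O O' : Par) (j : ℕ) (hj : j < numPoles (O * O').word) :
    subst u (O * O') j =
      if j < numPoles O.word then subst u O j * O' else O * subst u O' (j - numPoles O.word) := by
  induction O using WithOne.recOneCoe with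
  | one =>
    have h0 : numPoles (1 : Par).word = 0 := rfl
    simp [h0]
  | coe a =>
    induction O' using WithOne.recOneCoe with
    | one => rw [mul_one] at hj; rw [mul_one, mul_one, if_pos hj]
    | coe b => rfl

theorem numPoles_append (o o' : List Color) : numPoles (o ++ o') = numPoles o + numPoles o' := by
  rw [numPoles, List.length_append, polesBelow_append_right]; rfl

theorem numPoles_treeSkeleton (t : FreeMagma Color) :
    numPoles (treeSkeleton t).word = numPoles (treeWord t) := by
  induction t using FreeMagma.rec with
  | of c => cases c <;> rfl
  | mul a b iha ihb =>
    rw [treeSkeleton, word_mul, numPoles_append, iha, ihb, treeWord, numPoles_append]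

theorem polesBelow_lt_numPoles {o : List Color} {i : ℕ} (h : colorAt o i = Color.pole) :
    polesBelow (colorAt o) i < numPoles o :=
  Nat.count_strict_mono h (lt_of_colorAt h)

theorem treeSkeleton_replace_pole (F : Color → FreeMagma Color) (t : FreeMagma Color) (i : ℕ)
    (h : colorAt (treeWord t) i = Color.pole) :
    treeSkeleton (treeReplace F t i) =
      subst (treeSkeleton (F Color.pole)) (treeSkeleton t) (polesBelow (colorAt (treeWord t)) i) := by
  induction t using FreeMagma.rec generalizing i with
  | of c =>
    have := lt_of_colorAt h
    obtain rfl : i = 0 := by simpa [treeWord] using this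
    obtain rfl : c = Color.pole := h
    rfl
  | mul a b iha ihb =>
    have hj : polesBelow (colorAt (treeWord (a.mul b))) i <
        numPoles (treeSkeleton a * treeSkeleton b).word := by
      have := polesBelow_lt_numPoles h
      rwa [← numPoles_treeSkeleton] at this
    rw [treeSkeleton, subst_mul _ _ _ _ hj, numPoles_treeSkeleton, treeReplace]
    rw [treeWord] at h ⊢
    by_cases hi : i < (treeWord a).length
    · rw [colorAt_append_left hi] at h
      rw [if_pos hi, polesBelow_append_left hi.le, if_pos (polesBelow_lt_numPoles h), treeSkeleton,
        iha i h]
    · obtain ⟨k, rfl⟩ := Nat.exists_eq_add_of_le (not_lt.mp hi)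
      rw [colorAt_append_right (by omega), Nat.add_sub_cancel_left] at h
      rw [if_neg hi, polesBelow_append_right, if_neg (by omega), treeSkeleton,
        Nat.add_sub_cancel_left, Nat.add_sub_cancel_left, ihb k h]

theorem treeSkeleton_replace_strand (F : Color → FreeMagma Color)
    (hF : treeSkeleton (F Color.strand) = 1) (t : FreeMagma Color) (i : ℕ)
    (h : colorAt (treeWord t) i ≠ Color.pole) :
    treeSkeleton (treeReplace F t i) = treeSkeleton t := by
  induction t using FreeMagma.rec generalizing i with
  | of c =>
    cases i with
    | zero =>
      cases c with
      | pole => exact absurd rfl h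
      | strand => exact hF
    | succ i => rfl
  | mul a b iha ihb =>
    rw [treeReplace]
    rw [treeWord] at h
    by_cases hi : i < (treeWord a).length
    · rw [colorAt_append_left hi] at h
      rw [if_pos hi, treeSkeleton, iha i h, treeSkeleton]
    · rw [colorAt_append_right (not_lt.mp hi)] at h
      rw [if_neg hi, treeSkeleton, ihb _ h, treeSkeleton]

theorem skeleton_replace_eq (F : Color → FreeMagma Color)
    (hF : treeSkeleton (F Color.strand) = 1) {O O' : Par} (h : O.skeleton = O'.skeleton)
    {σ : Equiv.Perm ℕ} (hσ : IsMixedPerm O.word O'.word σ) (i : ℕ) :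
    (O.replace F i).skeleton = (O'.replace F (σ i)).skeleton := by
  have pole : ∀ (O : Par) (i : ℕ), colorAt O.word i = Color.pole → (O.replace F i).skeleton =
      subst (treeSkeleton (F Color.pole)) O.skeleton (polesBelow (colorAt O.word) i) := by
    intro O i hi
    induction O using WithOne.recOneCoe with
    | one => simp [word, colorAt] at hi
    | coe t => exact treeSkeleton_replace_pole F t i hi
  have strand : ∀ (O : Par) (i : ℕ), colorAt O.word i ≠ Color.pole →
      (O.replace F i).skeleton = O.skeleton := by
    intro O i hi
    induction O using WithOne.recOneCoe with
    | one => rfl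
    | coe t => exact treeSkeleton_replace_strand F hF t i hi
  have hc := hσ.color i
  by_cases hi : colorAt O.word i = Color.pole
  · rw [pole O i hi, pole O' (σ i) (hc.trans hi), h, hσ.polesBelow_eq hi]
  · rw [strand O i hi, strand O' (σ i) (by rwa [hc]), h]

end Par

namespace PaMB

/-- Extension operation: adding a straight pole or strand on the left, outermost. -/
noncomputable def extendLeft (c : Color) {O O' : Par} (f : O ⟶ O') :
    Par.letter c * O ⟶ Par.letter c * O' where
  perm := shiftPerm f.perm
  comb := f.comb.mapDomain shift
  isMixedPerm := by
    rw [Par.word_mul, Par.word_mul]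
    exact f.isMixedPerm.cons c
  isMixedBraid β h := by
    obtain ⟨γ, hγ, rfl⟩ := exists_of_mem_support_mapDomain h
    obtain ⟨h₁, h₂⟩ := f.isMixedBraid γ hγ
    rw [Par.word_mul, Par.word_mul]
    exact ⟨h₁.cons c, by rw [strandPerm_shift, h₂]⟩
  skeleton_eq := by rw [Par.skeleton_mul, Par.skeleton_mul, f.skeleton_eq]

/-- Extension operation: adding a straight pole or strand on the right, outermost. -/
def extendRight (c : Color) {O O' : Par} (f : O ⟶ O') :
    O * Par.letter c ⟶ O' * Par.letter c where
  perm := f.perm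
  comb := f.comb
  isMixedPerm := by
    rw [Par.word_mul, Par.word_mul]
    exact f.isMixedPerm.append c
  isMixedBraid β h := by
    obtain ⟨h₁, h₂⟩ := f.isMixedBraid β h
    rw [Par.word_mul, Par.word_mul]
    exact ⟨h₁.append c, h₂⟩
  skeleton_eq := by rw [Par.skeleton_mul, Par.skeleton_mul, f.skeleton_eq]

/-- Cabling operation: doubling the strand or pole at position `i` at the bottom. The two copies have
the color of the original and are closest to each other at both ends. -/
noncomputable def cabling {O O' : Par} (f : O ⟶ O') (i : ℕ) (hi : i < O.word.length) :
    O.double i ⟶ O'.double (f.perm i) where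
  perm := cablePerm i f.perm
  comb := f.comb.mapDomain (cable i)
  isMixedPerm := by
    rw [Par.double, Par.double, Par.word_replace, Par.word_replace]
    exact f.isMixedPerm.double hi
  isMixedBraid β h := by
    obtain ⟨γ, hγ, rfl⟩ := exists_of_mem_support_mapDomain h
    obtain ⟨h₁, h₂⟩ := f.isMixedBraid γ hγ
    rw [Par.double, Par.double, Par.word_replace, Par.word_replace, strandPerm_cable, ← h₂]
    exact ⟨h₁.double hi, rfl⟩
  skeleton_eq := Par.skeleton_replace_eq _ (mul_one 1) f.skeleton_eq f.isMixedPerm i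

/-- Changing the pole at position `i` at the bottom to a strand. -/
def poleToStrand {O O' : Par} (f : O ⟶ O') (i : ℕ) :
    O.toStrand i ⟶ O'.toStrand (f.perm i) where
  perm := f.perm
  comb := f.comb
  isMixedPerm := by
    rw [Par.toStrand, Par.toStrand, Par.word_replace, Par.word_replace]
    exact f.isMixedPerm.toStrand i
  isMixedBraid β h := by
    obtain ⟨h₁, h₂⟩ := f.isMixedBraid β h
    rw [Par.toStrand, Par.toStrand, Par.word_replace, Par.word_replace, ← h₂]
    exact ⟨h₁.toStrand i, rfl⟩
  skeleton_eq := Par.skeleton_replace_eq _ rfl f.skeleton_eq f.isMixedPerm i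

end PaMB

theorem IsMixedBraid.inv {o o' : List Color} {β : BraidInf} (h : IsMixedBraid o o' β) :
    IsMixedBraid o' o β⁻¹ where
  mem := by rw [h.length_eq]; exact inv_mem h.mem
  length_eq := h.length_eq.symm
  color i := by rw [← h.color, strandPerm_inv]; simp
  forget_eq := by
    have e : colorAt o' ∘ ⇑(footHom β⁻¹) = colorAt o := by
      rw [← colorAt_comp h.color]; ext; simp
    rw [forget_inv, e, h.forget_eq, inv_one]

theorem IsMixedBraid.isMixedPerm {o o' : List Color} {β : BraidInf} (h : IsMixedBraid o o' β) :
    IsMixedPerm o o' (strandPerm β) where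
  length_eq := h.length_eq
  fix _ hi := strandPerm_of_le h.mem hi
  color := h.color
  mono i j hi hj hij := by
    have key : ∀ i, colorAt o i = Color.pole →
        polesBelow (colorAt o') (strandPerm β i) = polesBelow (colorAt o) i := by
      intro i hi
      rw [← colorAt_comp h.color, ← forget_perm _ _ hi, h.forget_eq]
      simp [strandPerm]
    have h1 : polesBelow (colorAt o) i < polesBelow (colorAt o) j := Nat.count_strict_mono hi hij
    rw [← key i hi, ← key j hj] at h1
    by_contra hn
    have := Nat.count_monotone (fun i => colorAt o' i = Color.pole) (not_lt.mp hn)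
    exact absurd h1 (not_lt.mpr this)

namespace PaMB

/-- The morphism of **PaMB** given by one mixed braid: a parenthesized mixed braid. -/
noncomputable def ofBraid {O O' : Par} (β : BraidInf) (h : IsMixedBraid O.word O'.word β)
    (hs : O.skeleton = O'.skeleton) : O ⟶ O' where
  perm := strandPerm β
  isMixedPerm := h.isMixedPerm
  comb := MonoidAlgebra.single β 1
  isMixedBraid γ hγ := by
    obtain rfl := eq_of_mem_support_single hγ
    exact ⟨h, rfl⟩
  skeleton_eq := hs

theorem isMixedBraid_gen {a b : Color} (h : ¬ (a = Color.pole ∧ b = Color.pole)) :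
    IsMixedBraid [a, b] [b, a] (gen 0) where
  mem := gen_mem (by simp)
  length_eq := rfl
  color i := by
    rw [strandPerm_gen]
    rcases i with _ | _ | i
    · simp [colorAt]
    · simp [colorAt]
    · rw [swap_gt (by omega)]; simp [colorAt]
  forget_eq := by rw [forget_gen]; exact if_neg h

/-- The word consisting of one pole. -/
def p : Par := Par.letter Color.pole

/-- The word consisting of one strand. -/
def s : Par := Par.letter Color.strand

/-- The positive crossing of a pole and a strand (the pole passes over the strand). -/
noncomputable def sigmaPos : p * s ⟶ s * p :=
  ofBraid (gen 0) (isMixedBraid_gen (by simp)) rfl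

/-- The negative crossing of a pole and a strand (the pole passes under the strand). -/
noncomputable def sigmaNeg : p * s ⟶ s * p :=
  ofBraid (gen 0)⁻¹ (isMixedBraid_gen (by simp)).inv rfl

/-- The associativity morphism `(pp)s ⟶ p(ps)`, with trivial underlying braid. -/
noncomputable def alphaPPS : (p * p) * s ⟶ p * (p * s) :=
  ofBraid 1 (.one _) rfl

/-- The associativity morphism `(ps)p ⟶ p(sp)`, with trivial underlying braid. -/
noncomputable def alphaPSP : (p * s) * p ⟶ p * (s * p) :=
  ofBraid 1 (.one _) rfl

/-- The associativity morphism `(sp)p ⟶ s(pp)`, with trivial underlying braid. -/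
noncomputable def alphaSPP : (s * p) * p ⟶ s * (p * p) :=
  ofBraid 1 (.one _) rfl

/-- The five basic morphisms. -/
inductive IsBasic : ∀ {O O' : Par}, (O ⟶ O') → Prop
  | sigmaPos : IsBasic sigmaPos
  | sigmaNeg : IsBasic sigmaNeg
  | alphaPPS : IsBasic alphaPPS
  | alphaPSP : IsBasic alphaPSP
  | alphaSPP : IsBasic alphaSPP

/-- The basic morphisms, their inverses, and the images of these under repeated applications of the
operadic operations. -/
inductive IsElementary : ∀ {O O' : Par}, (O ⟶ O') → Prop
  | basic {O O' : Par} (f : O ⟶ O') : IsBasic f → IsElementary f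
  | inverse {O O' : Par} (e : O ≅ O') : IsBasic e.hom → IsElementary e.inv
  | extendLeft (c : Color) {O O' : Par} (f : O ⟶ O') :
      IsElementary f → IsElementary (extendLeft c f)
  | extendRight (c : Color) {O O' : Par} (f : O ⟶ O') :
      IsElementary f → IsElementary (extendRight c f)
  | cabling {O O' : Par} (f : O ⟶ O') (i : ℕ) (hi : i < O.word.length) :
      IsElementary f → IsElementary (cabling f i hi)
  | poleToStrand {O O' : Par} (f : O ⟶ O') (i : ℕ) (hi : colorAt O.word i = Color.pole) :
      IsElementary f → IsElementary (poleToStrand f i)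

/-- Finite (possibly empty) compositions of elementary morphisms. -/
inductive IsProduct : ∀ {O O' : Par}, (O ⟶ O') → Prop
  | id (O : Par) : IsProduct (𝟙 O)
  | comp {O O' O'' : Par} (f : O ⟶ O') (g : O' ⟶ O'') :
      IsElementary f → IsProduct g → IsProduct (f ≫ g)

/-- The morphism `f = (∑ cⱼ βⱼ, σ)` belongs to the `ℚ`-linear category generated by the elementary
morphisms: its first entry is a `ℚ`-linear combination of (first entries of) compositions of
elementary morphisms with the same source, target and underlying permutation `σ`. -/
def IsGenerated {O O' : Par} (f : O ⟶ O') : Prop :=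
  f.comb ∈ Submodule.span ℚ
    {x | ∃ g : O ⟶ O', IsProduct g ∧ g.perm = f.perm ∧ g.comb = x}

end PaMB

end MixedBraids

/-! The statement splits into a fact about braids and a fact about parentheses.

Braids: every mixed braid is a product of crossings between neighbours that are not both poles
(`IsMixedBraid.localBraid`). Call such products local braids. For each word and each index `j` there
is a standard crossing `poleCrossing j` of two consecutive poles, both of which pass in front of the
strands between them. Conjugation by these crossings sends local braids to local braids
(`LocalBraid.conj_poleCrossing`); for one crossing this is a consequence of Artin's relations.
Hence, in a color-preserving braid, all crossings of poles can be collected in the middle: the braid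
equals `h * s * h'`, where `h` and `h'` are local and `s` is a braid of the poles of a sorted word
`p ⋯ p s ⋯ s` (`exists_local_mul_poles_mul_local`). Forgetting the strands kills the local factors
and leaves `s` unchanged, so `s = 1` for a mixed braid.

Parentheses: iterated doubling, together with changing poles to strands, replaces a pole by any
nonempty parenthesized word, and a strand by any such word without poles (`ElementaryBraid.graft`).
Grafting into the three basic associators gives `(AB)C ⟶ A(BC)` whenever one of `A`, `B`, `C` has no
poles (`ElementaryBraid.assoc_tree`); grafting at an added outer pole puts an arbitrary word beside
a morphism. With these moves a strand can be carried through the parentheses to the place where it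
crosses its neighbour, so every local crossing lifts to some parenthesization of its target word
(`Swap.exists_braidProduct`). Moreover, two parenthesizations of one word with the same skeleton are
joined by a product of elementary morphisms with trivial braid (`braidProduct_one_of_word_eq`): the
skeleton fixes the bracketing of the poles, and the strands can be moved freely through the
brackets.

A mixed braid is therefore lifted crossing by crossing, and the resulting parenthesization is
corrected at the end. The linear statement follows by treating each braid in the support separately.
-/

namespace MixedBraids

/-! ### Products of local crossings -/

/-- `Swap o o' k`: the word `o'` arises from `o` by exchanging the letters at the positions `k` and
`k + 1`, which are not both poles. -/
inductive Swap : List Color → List Color → ℕ → Prop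
  | head {a b : Color} (v : List Color) (h : ¬ (a = Color.pole ∧ b = Color.pole)) :
      Swap (a :: b :: v) (b :: a :: v) 0
  | cons (c : Color) {o o' : List Color} {k : ℕ} : Swap o o' k → Swap (c :: o) (c :: o') (k + 1)

theorem Swap.symm {o o' : List Color} {k : ℕ} (h : Swap o o' k) : Swap o' o k := by
  induction h with
  | head v h => exact .head v fun h' => h h'.symm
  | cons c _ ih => exact .cons c ih

theorem Swap.strand_head (a : Color) (v : List Color) :
    Swap (Color.strand :: a :: v) (a :: Color.strand :: v) 0 := .head v (by simp)

theorem Swap.head_strand (a : Color) (v : List Color) :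
    Swap (a :: Color.strand :: v) (Color.strand :: a :: v) 0 := .head v (by simp)

/-- Products of crossings between neighbours that are not both poles. -/
inductive LocalBraid : List Color → List Color → BraidInf → Prop
  | one (o : List Color) : LocalBraid o o 1
  | gen_mul {o o' o'' : List Color} {k : ℕ} {β : BraidInf} :
      Swap o o' k → LocalBraid o' o'' β → LocalBraid o o'' (gen k * β)
  | inv_mul {o o' o'' : List Color} {k : ℕ} {β : BraidInf} :
      Swap o o' k → LocalBraid o' o'' β → LocalBraid o o'' ((gen k)⁻¹ * β)

theorem Swap.local {o o' : List Color} {k : ℕ} (h : Swap o o' k) : LocalBraid o o' (gen k) := by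
  simpa using LocalBraid.gen_mul h (.one o')

theorem Swap.local_inv {o o' : List Color} {k : ℕ} (h : Swap o o' k) :
    LocalBraid o o' (gen k)⁻¹ := by
  simpa using LocalBraid.inv_mul h (.one o')

namespace LocalBraid

variable {o o' o'' : List Color} {β γ : BraidInf}

theorem mul (h : LocalBraid o o' β) (h' : LocalBraid o' o'' γ) : LocalBraid o o'' (β * γ) := by
  induction h with
  | one => simpa using h'
  | gen_mul hs _ ih => rw [mul_assoc]; exact .gen_mul hs (ih h')
  | inv_mul hs _ ih => rw [mul_assoc]; exact .inv_mul hs (ih h')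

theorem inv (h : LocalBraid o o' β) : LocalBraid o' o β⁻¹ := by
  induction h with
  | one => simpa using one _
  | gen_mul hs _ ih => rw [mul_inv_rev]; exact ih.mul hs.symm.local_inv
  | inv_mul hs _ ih => rw [mul_inv_rev, inv_inv]; exact ih.mul hs.symm.local

theorem cons (h : LocalBraid o o' β) (c : Color) : LocalBraid (c :: o) (c :: o') (shift β) := by
  induction h with
  | one => simpa using one _
  | gen_mul hs _ ih => rw [map_mul, shift_gen]; exact .gen_mul (.cons c hs) ih
  | inv_mul hs _ ih => rw [map_mul, map_inv, shift_gen]; exact .inv_mul (.cons c hs) ih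

end LocalBraid

/-- The two-letter crossing `isMixedBraid_gen`, padded with straight strands and poles on both
sides. -/
theorem Swap.isMixedBraid {o o' : List Color} {k : ℕ} (h : Swap o o' k) :
    IsMixedBraid o o' (gen k) := by
  induction h with
  | @head a b v h =>
    induction v using List.reverseRecOn with
    | nil => exact PaMB.isMixedBraid_gen h
    | append_singleton v c ih => simpa using ih.append c
  | cons c _ ih => simpa using ih.cons c

/-- The easy inclusion; the converse is `IsMixedBraid.localBraid`. -/
theorem LocalBraid.isMixedBraid {o o' : List Color} {β : BraidInf} (h : LocalBraid o o' β) :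
    IsMixedBraid o o' β := by
  induction h with
  | one => exact .one _
  | gen_mul hs _ ih => exact hs.isMixedBraid.mul ih
  | inv_mul hs _ ih => exact hs.symm.isMixedBraid.inv.mul ih

/-! ### Conjugating local braids by crossings of poles -/

section BraidRelation

variable {G : Type*} [Group G] {a b : G}

theorem conj_of_braid (h : a * b * a = b * a * b) : a * b * a⁻¹ = b⁻¹ * a * b := by
  rw [mul_inv_eq_iff_eq_mul, mul_assoc, mul_assoc, eq_inv_mul_iff_mul_eq, ← mul_assoc, ← mul_assoc,
    ← h]

/-- Squaring `conj_of_braid`. When `a` on the left crosses two poles and `b` crosses a strand with a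
pole, every letter on the right crosses the strand with a pole, so the conjugate of a loop becomes
visibly local. -/
theorem conj_sq_of_braid (h : a * b * a = b * a * b) : a * b * b * a⁻¹ = b⁻¹ * a * a * b :=
  calc a * b * b * a⁻¹ = (a * b * a⁻¹) * (a * b * a⁻¹) := by group
    _ = (b⁻¹ * a * b) * (b⁻¹ * a * b) := by rw [conj_of_braid h]
    _ = b⁻¹ * a * a * b := by group

theorem conj_inv_sq_of_braid (h : a * b * a = b * a * b) : a⁻¹ * b * b * a = b * a * a * b⁻¹ :=
  (conj_sq_of_braid h.symm).symm

/-- The induction step of `localBraid_loop`. There `b * z * b⁻¹` is the band across one more strand,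
and the right-hand side contains the smaller loop `z * b * b * z⁻¹` conjugated by the local braid `b
* a`. -/
theorem conj_conj_sq_of_braid {z : G} (h : a * b * a = b * a * b) (hz : Commute a z) :
    b * z * b⁻¹ * a * a * (b * z * b⁻¹)⁻¹ = b * (a * (z * b * b * z⁻¹ * (a⁻¹ * b⁻¹))) :=
  calc _ = b * z * (b⁻¹ * a * a * b) * z⁻¹ * b⁻¹ := by group
    _ = b * (z * a) * b * b * (z * a)⁻¹ * b⁻¹ := by rw [← conj_sq_of_braid h]; group
    _ = _ := by rw [← hz.eq]; group

end BraidRelation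

theorem gen_zero_commute (β : BraidInf) : Commute (gen 0) (shift (shift β)) := by
  induction β using braid_induction with
  | one => simp
  | gen' k => rw [shift_gen, shift_gen]; exact gen_comm (by omega)
  | mul β γ hβ hγ => simpa using hβ.mul_right hγ
  | inv β hβ => simpa using hβ.inv_right

/-- The crossing of a pole with the next pole in `o`, where `o` is the word to the right of the first
of these two poles; the first pole passes over the strands between them. -/
def bandFrom : List Color → BraidInf
  | [] => 1
  | Color.pole :: _ => gen 0
  | Color.strand :: o => gen 0 * shift (bandFrom o) * (gen 0)⁻¹

/-- The crossing of the poles number `j` and `j + 1` of a word (and `1` if these do not exist). -/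
def poleCrossing : ℕ → List Color → BraidInf
  | _, [] => 1
  | j, Color.strand :: o => shift (poleCrossing j o)
  | 0, Color.pole :: o => bandFrom o
  | j + 1, Color.pole :: o => shift (poleCrossing j o)

/-- A crossing beyond the next pole commutes with the band, and one between two strands under the
band does too. If a strand crosses the next pole, the band gains or loses this strand, and a
computation in three strands gives a local word. Crossings further right reduce to these by removing
the first strand under the band. -/
theorem localBraid_bandFrom {w w' : List Color} {k : ℕ} (h : Swap w w' k) :
    LocalBraid (Color.pole :: w) (Color.pole :: w')
        (bandFrom w * gen (k + 1) * (bandFrom w')⁻¹) ∧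
      LocalBraid (Color.pole :: w) (Color.pole :: w')
        ((bandFrom w)⁻¹ * gen (k + 1) * bandFrom w') := by
  have hb := gen_braid 0
  induction h with
  | @head a b v h =>
    have sw := Swap.cons Color.pole (Swap.head v h)
    cases a with
    | strand =>
      cases b with
      | strand =>
        -- The band is `Z` conjugated by `gen 0 * gen 1`. The same conjugation takes `gen 0`, which
        -- commutes with `Z`, to `gen 1`.
        have hc : Commute (bandFrom (Color.strand :: Color.strand :: v)) (gen 1) := by
          simp only [bandFrom, map_mul, map_inv, shift_gen]
          set Z := shift (shift (bandFrom v))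
          have hZ : gen 0 * Z = Z * gen 0 := gen_zero_commute _
          have e : gen 0 * (gen 1 * Z * (gen 1)⁻¹) * (gen 0)⁻¹ =
            gen 0 * gen 1 * Z * (gen 0 * gen 1)⁻¹ := by group
          have e1 : gen 1 * (gen 0 * gen 1) = gen 0 * gen 1 * gen 0 := by
            rw [← mul_assoc]; exact hb.symm
          have e2 : (gen 0 * gen 1)⁻¹ * gen 1 = gen 0 * (gen 0 * gen 1)⁻¹ := by
            rw [inv_mul_eq_iff_eq_mul, ← mul_assoc, eq_mul_inv_iff_mul_eq, e1]
          rw [zero_add, e]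
          show _ * _ = _ * _
          rw [mul_assoc _ _ (gen 1), e2, ← mul_assoc, ← mul_assoc, ← mul_assoc, ← mul_assoc,
            mul_assoc _ Z (gen 0), ← hZ, ← mul_assoc, ← hb, zero_add]
        rw [hc.eq, mul_assoc, mul_assoc, hc.symm.eq]
        simpa using sw.local
      | pole =>
        have l0 : Swap (Color.pole :: Color.strand :: Color.pole :: v)
          (Color.strand :: Color.pole :: Color.pole :: v) 0 := .head_strand _ _
        have e : bandFrom (Color.strand :: Color.pole :: v) = gen 0 * gen 1 * (gen 0)⁻¹ := by
          simp [bandFrom]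
        have e' : bandFrom (Color.pole :: Color.strand :: v) = gen 0 := rfl
        rw [e, e', zero_add]
        constructor
        -- Read from the left, the new word passes through psp, pps, psp, spp, psp, pps, so only the
        -- strand is ever crossed with a pole.
        · have : gen 0 * gen 1 * (gen 0)⁻¹ * gen 1 * (gen 0)⁻¹ =
              (gen 1)⁻¹ * ((gen 1)⁻¹ * (gen 0 * (gen 0 * gen 1))) := by
            have := conj_sq_of_braid hb
            rw [conj_of_braid hb, mul_assoc (_ * _), mul_assoc (_ * _), ← mul_assoc (gen 1),
              mul_assoc _ (gen 0), ← mul_assoc (gen 0), ← mul_assoc (gen 0), this]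
            group
          rw [this]
          exact .inv_mul sw (.inv_mul sw.symm (.gen_mul l0 (.gen_mul l0.symm sw.local)))
        · have : (gen 0 * gen 1 * (gen 0)⁻¹)⁻¹ * gen 1 * gen 0 =
              gen 0 * (gen 0 * (gen 1)⁻¹) := by
            have := conj_inv_sq_of_braid hb
            rw [conj_of_braid hb]
            calc ((gen 1)⁻¹ * gen 0 * gen 1)⁻¹ * gen 1 * gen 0 =
                (gen 1)⁻¹ * ((gen 0)⁻¹ * gen 1 * gen 1 * gen 0) := by group
              _ = _ := by rw [this, zero_add]; group
          rw [this]
          exact .gen_mul l0 (.gen_mul l0.symm sw.local_inv)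
    | pole =>
      cases b with
      | pole => simp at h
      | strand =>
        have e : bandFrom (Color.strand :: Color.pole :: v) = gen 0 * gen 1 * (gen 0)⁻¹ := by
          simp [bandFrom]
        have e' : bandFrom (Color.pole :: Color.strand :: v) = gen 0 := rfl
        rw [e, e', zero_add]
        -- Here the strand slides behind the crossing of the two poles, and both conjugates are `gen
        -- 1` itself.
        have e1 : gen 0 * gen 1 * (gen 0 * gen 1 * (gen 0)⁻¹)⁻¹ = gen 1 := by
          rw [mul_inv_eq_iff_eq_mul, ← mul_assoc, ← mul_assoc, ← hb]
          group
        have e2 : (gen 0)⁻¹ * gen 1 * (gen 0 * gen 1 * (gen 0)⁻¹) = gen 1 := by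
          calc _ = (gen 0)⁻¹ * (gen 1 * gen 0 * gen 1) * (gen 0)⁻¹ := by group
            _ = (gen 0)⁻¹ * (gen 0 * gen 1 * gen 0) * (gen 0)⁻¹ := by rw [hb]
            _ = gen 1 := by group
        rw [e1, e2]
        exact ⟨sw.local, sw.local⟩
  | @cons c o o' k hs ih =>
    have hk : gen 0 * gen (k + 1 + 1) = gen (k + 1 + 1) * gen 0 := gen_comm (by omega)
    have sw := Swap.cons Color.pole (Swap.cons c hs)
    cases c with
    | pole =>
      simp only [bandFrom]
      rw [hk, mul_assoc, mul_assoc, ← hk]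
      simpa using sw.local
    | strand =>
      have l : ∀ o, Swap (Color.pole :: Color.strand :: o) (Color.strand :: Color.pole :: o) 0 :=
        fun _ => .head_strand _ _
      have e : (gen 0)⁻¹ * gen (k + 1 + 1) * gen 0 = shift (gen (k + 1)) := by
        rw [mul_assoc, ← hk]; simp
      -- The pole steps over the first strand, the braid of the induction hypothesis takes place to
      -- the right of that strand, and the pole position is moved back.
      have conj : ∀ β : BraidInf, LocalBraid (Color.pole :: o) (Color.pole :: o') β →
          LocalBraid (Color.pole :: Color.strand :: o) (Color.pole :: Color.strand :: o')
            (gen 0 * (shift β * (gen 0)⁻¹)) := fun β hβ =>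
        .gen_mul (l o) ((hβ.cons _).mul (l o').symm.local_inv)
      have c1 := conj _ ih.1
      have c2 := conj _ ih.2
      simp only [map_mul, map_inv] at c1 c2
      rw [← e] at c1 c2
      simp only [bandFrom]
      constructor
      · convert c1 using 1; group
      · convert c2 using 1; group

/-- The loop of a strand around a pole, conjugated by the crossing of this pole with the next one.
It becomes a loop around the next pole, conjugated by local crossings. This is the essential case of
`localBraid_poleCrossing_gen`. -/
theorem localBraid_loop (v : List Color) :
    LocalBraid (Color.strand :: Color.pole :: v) (Color.strand :: Color.pole :: v)
        (shift (bandFrom v) * gen 0 * gen 0 * (shift (bandFrom v))⁻¹) ∧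
      LocalBraid (Color.strand :: Color.pole :: v) (Color.strand :: Color.pole :: v)
        ((shift (bandFrom v))⁻¹ * gen 0 * gen 0 * shift (bandFrom v)) := by
  have hb := gen_braid 0
  induction v with
  | nil =>
    have l := Swap.strand_head Color.pole []
    simpa [bandFrom] using l.local.mul l.symm.local
  | cons c v ih =>
    have l := Swap.strand_head Color.pole (c :: v)
    cases c with
    | pole =>
      have l1 := Swap.cons Color.pole (Swap.strand_head Color.pole v)
      simp only [bandFrom, shift_gen]
      rw [conj_sq_of_braid hb.symm, conj_inv_sq_of_braid hb.symm]
      simp only [mul_assoc]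
      exact ⟨.inv_mul l (.gen_mul l1 (.gen_mul l1.symm l.symm.local)),
        .gen_mul l (.gen_mul l1 (.gen_mul l1.symm l.symm.local_inv))⟩
    | strand =>
      simp only [bandFrom, map_mul, map_inv, shift_gen]
      have l1 : Swap (Color.strand :: Color.pole :: Color.strand :: v)
        (Color.strand :: Color.strand :: Color.pole :: v) 1 := .cons _ (.head_strand _ _)
      have l0 : Swap (Color.strand :: Color.strand :: Color.pole :: v)
        (Color.strand :: Color.strand :: Color.pole :: v) 0 := .head _ (by simp)
      have conj : ∀ β : BraidInf,
          LocalBraid (Color.strand :: Color.pole :: v) (Color.strand :: Color.pole :: v) β →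
          LocalBraid (Color.strand :: Color.pole :: Color.strand :: v)
            (Color.strand :: Color.pole :: Color.strand :: v)
            (gen 1 * (gen 0 * (shift β * ((gen 0)⁻¹ * (gen 1)⁻¹)))) := fun β hβ =>
        .gen_mul l1 (.gen_mul l0 ((hβ.cons _).mul (.inv_mul l0 l1.symm.local_inv)))
      have c1 := conj _ ih.1
      have c2 := conj _ ih.2
      simp only [map_mul, map_inv, shift_gen] at c1 c2
      have hZ := gen_zero_commute (bandFrom v)
      have key := conj_conj_sq_of_braid hb hZ.inv_right
      simp only [mul_inv_rev, inv_inv] at key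
      exact ⟨by convert c1 using 1; exact conj_conj_sq_of_braid hb hZ, by
        convert c2 using 1
        convert key using 1
        group⟩

theorem localBraid_poleCrossing_gen {o o' : List Color} {k : ℕ} (h : Swap o o' k) (j : ℕ) :
    LocalBraid o o' (poleCrossing j o * gen k * (poleCrossing j o')⁻¹) ∧
      LocalBraid o o' ((poleCrossing j o)⁻¹ * gen k * poleCrossing j o') := by
  -- A pole crossing that avoids the first two positions commutes with `gen 0`.
  have far : ∀ {v a b}, Swap (a :: b :: v) (b :: a :: v) 0 → ∀ β : BraidInf,
      LocalBraid (a :: b :: v) (b :: a :: v) (shift (shift β) * gen 0 * (shift (shift β))⁻¹) ∧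
      LocalBraid (a :: b :: v) (b :: a :: v) ((shift (shift β))⁻¹ * gen 0 * shift (shift β)) := by
    intro v a b hs β
    have hc := (gen_zero_commute β).eq
    rw [← hc, mul_assoc, mul_assoc, hc]
    simpa using hs.local
  induction h generalizing j with
  | @head a b v h =>
    have sw := Swap.head v h
    cases a with
    | strand =>
      cases b with
      | strand => exact far sw _
      | pole =>
        cases j with
        | succ j => exact far sw _
        | zero =>
          -- The pole crossings of the two words differ by conjugation with `gen 0`, so a conjugated
          -- loop followed by `(gen 0)⁻¹` remains.
          simp only [poleCrossing, bandFrom]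
          obtain ⟨h1, h2⟩ := localBraid_loop v
          constructor
          · convert h1.mul sw.local_inv using 1; group
          · convert h2.mul sw.local_inv using 1; group
    | pole =>
      cases b with
      | pole => simp at h
      | strand =>
        cases j with
        | succ j => exact far sw _
        | zero =>
          simp only [poleCrossing, bandFrom]
          constructor
          · convert sw.local using 1; group
          · convert sw.local using 1; group
  | @cons c o o' k hs ih =>
    cases c with
    | strand => simpa only [poleCrossing, map_mul, map_inv, shift_gen] using
          And.intro ((ih j).1.cons .strand) ((ih j).2.cons .strand)
    | pole =>
      cases j with
      | zero => exact localBraid_bandFrom hs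
      | succ j => simpa only [poleCrossing, map_mul, map_inv, shift_gen] using
          And.intro ((ih j).1.cons .pole) ((ih j).2.cons .pole)

/-- Local braids are normalized by the crossings of poles. -/
theorem LocalBraid.conj_poleCrossing {o o' : List Color} {β : BraidInf} (h : LocalBraid o o' β)
    (j : ℕ) : LocalBraid o o' (poleCrossing j o * β * (poleCrossing j o')⁻¹) ∧
      LocalBraid o o' ((poleCrossing j o)⁻¹ * β * poleCrossing j o') := by
  induction h with
  | one => simpa using one _
  | gen_mul hs _ ih =>
    have hg := localBraid_poleCrossing_gen hs j
    exact ⟨by convert hg.1.mul ih.1 using 1; group, by convert hg.2.mul ih.2 using 1; group⟩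
  | inv_mul hs _ ih =>
    have hg := localBraid_poleCrossing_gen hs.symm j
    exact ⟨by convert hg.1.inv.mul ih.1 using 1; group, by convert hg.2.inv.mul ih.2 using 1; group⟩

/-! ### Factoring a braid through a sorted word -/

/-- The word `p ⋯ p s ⋯ s`. -/
def sortedWord (m n : ℕ) : List Color :=
  List.replicate m Color.pole ++ List.replicate n Color.strand

theorem exists_localBraid_sortedWord (o : List Color) :
    ∃ m n β, LocalBraid o (sortedWord m n) β := by
  have move : ∀ m n, ∃ β, LocalBraid (Color.strand :: sortedWord m n) (sortedWord m (n + 1)) β := by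
    intro m n
    induction m with
    | zero => exact ⟨1, .one _⟩
    | succ m ih =>
      obtain ⟨β, hβ⟩ := ih
      exact ⟨_, .gen_mul (Swap.strand_head Color.pole (sortedWord m n)) (hβ.cons _)⟩
  induction o with
  | nil => exact ⟨0, 0, 1, .one _⟩
  | cons c o ih =>
    obtain ⟨m, n, β, hβ⟩ := ih
    cases c with
    | pole => exact ⟨m + 1, n, _, hβ.cons _⟩
    | strand =>
      obtain ⟨γ, hγ⟩ := move m n
      exact ⟨m, n + 1, _, (hβ.cons _).mul hγ⟩

theorem bandFrom_replicate_strand (n : ℕ) : bandFrom (List.replicate n Color.strand) = 1 := by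
  induction n with
  | zero => rfl
  | succ n ih => simp [List.replicate_succ, bandFrom, ih]

/-- In a sorted word no strand separates two poles, so a pole crossing is an Artin generator of the
first `m` positions, or `1` when the poles do not exist. -/
theorem poleCrossing_sortedWord_mem (m n j : ℕ) :
    poleCrossing j (sortedWord m n) ∈ braidSubgroup m := by
  induction m generalizing j with
  | zero =>
    have : poleCrossing j (sortedWord 0 n) = 1 := by
      induction n with
      | zero => simp [sortedWord, poleCrossing]
      | succ n ih =>
        have : sortedWord 0 (n + 1) = Color.strand :: sortedWord 0 n := rfl
        rw [this, poleCrossing, ih, map_one]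
    rw [this]
    exact one_mem _
  | succ m ih =>
    have e : sortedWord (m + 1) n = Color.pole :: sortedWord m n := rfl
    rw [e]
    cases j with
    | succ j => exact shift_mem (ih j)
    | zero =>
      rw [poleCrossing]
      cases m with
      | zero => simp [sortedWord, bandFrom_replicate_strand]
      | succ m => exact gen_mem (by omega)

/-- For adjacent poles the band passes over no strands; `j` is the number of poles in `u`. -/
theorem exists_poleCrossing_eq_gen (u v : List Color) :
    ∃ j, poleCrossing j (u ++ Color.pole :: Color.pole :: v) = gen u.length := by
  induction u with
  | nil => exact ⟨0, rfl⟩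
  | cons c u ih =>
    obtain ⟨j, hj⟩ := ih
    cases c with
    | pole => exact ⟨j + 1, by simp [poleCrossing, hj]⟩
    | strand => exact ⟨j, by simp [poleCrossing, hj]⟩

theorem Swap.of_append (u : List Color) {a b : Color} (v : List Color)
    (h : ¬ (a = Color.pole ∧ b = Color.pole)) :
    Swap (u ++ a :: b :: v) (u ++ b :: a :: v) u.length := by
  induction u with
  | nil => exact .head v h
  | cons c u ih => exact .cons c ih

theorem colorAt_swap (u : List Color) (a b : Color) (v : List Color) (i : ℕ) :
    colorAt (u ++ b :: a :: v) (Equiv.swap u.length (u.length + 1) i) =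
      colorAt (u ++ a :: b :: v) i := by
  simp only [colorAt, Equiv.swap_apply_def]
  split_ifs with h1 h2
  · subst h1; simp
  · subst h2; simp
  · rcases lt_or_ge i u.length with h | h
    · simp [List.getElem?_append_left h]
    · obtain ⟨d, rfl⟩ : ∃ d, i = u.length + (d + 2) := ⟨i - u.length - 2, by omega⟩
      simp [List.getElem?_append_right]

theorem eq_of_colorAt_eq {o o' : List Color} (hl : o'.length = o.length)
    (h : ∀ i, colorAt o' i = colorAt o i) : o = o' := by
  refine List.ext_getElem hl.symm fun i h1 h2 => ?_
  simpa [colorAt, h1, h2] using (h i).symm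

/-- Every braid with compatible colors is a local braid, followed by a braid of the poles and
another local braid. -/
theorem exists_local_mul_poles_mul_local {o : List Color} {m n : ℕ} {δ : BraidInf}
    (hδ : LocalBraid o (sortedWord m n) δ) {l : ℕ} {β : BraidInf} (hβ : β ∈ braidSubgroup l) :
    ∀ o' : List Color, o.length = l → o'.length = l →
      (∀ i, colorAt o' (strandPerm β i) = colorAt o i) →
      ∃ h s h', LocalBraid o (sortedWord m n) h ∧ s ∈ braidSubgroup m ∧
        LocalBraid (sortedWord m n) o' h' ∧ β = h * s * h' := by
  have split : ∀ (o' : List Color) (k : ℕ), k + 1 < o'.length →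
      ∃ u a b v, o' = u ++ b :: a :: v ∧ u.length = k := by
    intro o' k hk
    refine ⟨o'.take k, o'[k + 1], o'[k], o'.drop (k + 2), ?_, by simp; omega⟩
    rw [← List.drop_eq_getElem_cons, ← List.drop_eq_getElem_cons, List.take_append_drop]
  -- Letters are split off at the top, so `o`, the sorted word and `δ` stay fixed and only `o'`
  -- varies.
  induction hβ using Subgroup.closure_induction_right with
  | one =>
    intro o' hl hl' hc
    obtain rfl := eq_of_colorAt_eq (hl'.trans hl.symm) (by simpa [strandPerm] using hc)
    exact ⟨δ, 1, δ⁻¹, hδ, one_mem _, hδ.inv, by group⟩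
  | mul_right β _ x hx ih =>
    obtain ⟨k, hk, rfl⟩ := hx
    intro o'' hl hl' hc
    obtain ⟨u, a, b, v, rfl, rfl⟩ := split o'' k (by omega)
    obtain ⟨h, s, h', hh, hs, hh', rfl⟩ := ih (u ++ a :: b :: v) hl (by simpa using hl') (by
      intro i
      rw [← hc i, strandPerm_mul, Equiv.trans_apply, strandPerm_gen, colorAt_swap])
    by_cases hab : a = Color.pole ∧ b = Color.pole
    · obtain ⟨rfl, rfl⟩ := hab
      obtain ⟨j, hj⟩ := exists_poleCrossing_eq_gen u v
      -- The new crossing is the pole crossing `c'` of the top word. With `c` the one of the sorted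
      -- word, `h' * c' = c * (c⁻¹ * h' * c')`: `c` joins `s`, and the bracket is local.
      refine ⟨h, s * poleCrossing j (sortedWord m n), _, hh,
        mul_mem hs (poleCrossing_sortedWord_mem m n j), (hh'.conj_poleCrossing j).2, ?_⟩
      rw [hj]
      group
    · exact ⟨h, s, _, hh, hs, hh'.mul (Swap.of_append u v hab).local, by group⟩
  | mul_inv_cancel β _ x hx ih =>
    obtain ⟨k, hk, rfl⟩ := hx
    intro o'' hl hl' hc
    obtain ⟨u, a, b, v, rfl, rfl⟩ := split o'' k (by omega)
    obtain ⟨h, s, h', hh, hs, hh', rfl⟩ := ih (u ++ a :: b :: v) hl (by simpa using hl') (by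
      intro i
      rw [← hc i, strandPerm_mul, Equiv.trans_apply, strandPerm_inv, strandPerm_gen,
        Equiv.swap_inv, colorAt_swap])
    by_cases hab : a = Color.pole ∧ b = Color.pole
    · obtain ⟨rfl, rfl⟩ := hab
      obtain ⟨j, hj⟩ := exists_poleCrossing_eq_gen u v
      -- The same with `h' * c'⁻¹ = c⁻¹ * (c * h' * c'⁻¹)`.
      refine ⟨h, s * (poleCrossing j (sortedWord m n))⁻¹, _, hh,
        mul_mem hs (inv_mem (poleCrossing_sortedWord_mem m n j)), (hh'.conj_poleCrossing j).1, ?_⟩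
      rw [hj]
      group
    · exact ⟨h, s, _, hh, hs, hh'.mul (Swap.of_append u v hab).local_inv, by group⟩

theorem forget_all_poles (β : BraidInf) : forget (fun _ => Color.pole) β = β := by
  have e : ∀ β : BraidInf, (fun _ : ℕ => Color.pole) ∘ footHom β = fun _ => Color.pole :=
    fun _ => rfl
  induction β using braid_induction with
  | one => exact forget_one _
  | gen' k => simp [forget_gen, forgetVal, polesBelow_all]
  | mul β γ hβ hγ => rw [forget_mul, e, hβ, hγ]
  | inv β hβ => rw [forget_inv, e, hβ]

/-- A mixed braid is a product of crossings between neighbours that are not both poles. -/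
theorem IsMixedBraid.localBraid {o o' : List Color} {β : BraidInf} (h : IsMixedBraid o o' β) :
    LocalBraid o o' β := by
  obtain ⟨m, n, δ, hδ⟩ := exists_localBraid_sortedWord o
  obtain ⟨γ, s, γ', hγ, hs, hγ', rfl⟩ :=
    exists_local_mul_poles_mul_local hδ h.mem o' rfl h.length_eq h.color
  have hs1 : s = 1 := by
    -- Removing the local factors shows that `s` is itself a mixed braid of the sorted word. It
    -- involves only the first `m` positions, which are all poles, so forgetting the strands does
    -- not change it.
    have e := ((hγ.isMixedBraid.inv.mul h).mul hγ'.isMixedBraid.inv).forget_eq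
    rw [show γ⁻¹ * (γ * s * γ') * γ'⁻¹ = s by group] at e
    have hm : ∀ i < m, colorAt (sortedWord m n) i = Color.pole := by
      intro i hi
      rw [sortedWord, colorAt_append_left (by simpa using hi)]
      simp [colorAt, hi]
    rwa [forget_congr hs hm, forget_all_poles] at e
  rw [hs1, mul_one]
  exact hγ.mul hγ'

/-! ### Doubling straight strands beside a braid -/

theorem cable_zero_shift (β : BraidInf) : cable 0 (shift β) = shift (shift β) := by
  have h0 : ∀ β : BraidInf, strandPerm (shift β) 0 = 0 := fun β => by simp [strandPerm_shift]
  induction β using braid_induction with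
  | one => simp [cable_one]
  | gen' k => simp [cable_gen, cableVal_lt]
  | mul β γ hβ hγ => rw [map_mul, cable_mul, h0, hβ, hγ, map_mul]
  | inv β hβ => rw [map_inv, cable_inv, ← map_inv, h0, hβ, map_inv, map_inv]

theorem cable_succ_shift (i : ℕ) (β : BraidInf) : cable (i + 1) (shift β) = shift (cable i β) := by
  refine cocycle_ext (act := fun i β => strandPerm β i)
    (F := fun i β => cable (i + 1) (shift β)) (G := fun i β => shift (cable i β))
    ?_ ?_ ?_ ?_ ?_ i β
  · intro x β γ; simp [strandPerm_mul]
  · intro x; simp [strandPerm]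
  · intro x β γ; simp [cable_mul, strandPerm_shift]
  · intro x β γ; simp [cable_mul]
  · intro i k
    simp only [shift_gen, cable_gen, cableVal]
    split_ifs <;> simp <;> omega

/-- Doubling any one of the `k + 1` straight strands on the left merely adds another one. -/
theorem cable_shift_iterate {j k : ℕ} (h : j ≤ k) (β : BraidInf) :
    cable j (shift^[k + 1] β) = shift^[k + 2] β := by
  induction j generalizing k with
  | zero => rw [Function.iterate_succ_apply', cable_zero_shift, Function.iterate_succ_apply',
      Function.iterate_succ_apply']
  | succ j ih =>
    obtain ⟨k, rfl⟩ : ∃ n, k = n + 1 := ⟨k - 1, by omega⟩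
    rw [Function.iterate_succ_apply', cable_succ_shift, ih (by omega),
      ← Function.iterate_succ_apply' shift]

theorem strandPerm_shift_iterate {j k : ℕ} (h : j < k) (β : BraidInf) :
    strandPerm (shift^[k] β) j = j := by
  induction k generalizing j with
  | zero => omega
  | succ k ih =>
    rw [Function.iterate_succ_apply', strandPerm_shift]
    cases j with
    | zero => rfl
    | succ j => rw [shiftPerm_succ, ih (by omega)]

theorem cable_of_le {l : ℕ} {β : BraidInf} (hβ : β ∈ braidSubgroup l) {i : ℕ} (hi : l ≤ i) :
    cable i β = β := by
  induction hβ using Subgroup.closure_induction with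
  | mem x hx => obtain ⟨k, hk, rfl⟩ := hx; rw [cable_gen, cableVal_gt (by omega)]
  | one => exact cable_one i
  | mul x y hx _ ihx ihy => rw [cable_mul, strandPerm_of_le hx hi, ihx, ihy]
  | inv x hx ih => rw [cable_inv, strandPerm_of_le (inv_mem hx) hi, ih]

/-! ### Elementary morphisms given by a single braid -/

open PaMB Par

/-- The pairs of parenthesized words and the braids of elementary morphisms given by one braid. -/
inductive ElementaryBraid : Par → Par → BraidInf → Prop
  | cross : ElementaryBraid (p * s) (s * p) (gen 0)
  | crossInv : ElementaryBraid (p * s) (s * p) (gen 0)⁻¹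
  | cross' : ElementaryBraid (s * p) (p * s) (gen 0)
  | crossInv' : ElementaryBraid (s * p) (p * s) (gen 0)⁻¹
  | pps : ElementaryBraid ((p * p) * s) (p * (p * s)) 1
  | psp : ElementaryBraid ((p * s) * p) (p * (s * p)) 1
  | spp : ElementaryBraid ((s * p) * p) (s * (p * p)) 1
  | pps' : ElementaryBraid (p * (p * s)) ((p * p) * s) 1
  | psp' : ElementaryBraid (p * (s * p)) ((p * s) * p) 1
  | spp' : ElementaryBraid (s * (p * p)) ((s * p) * p) 1
  | left (c : Color) {O O' : Par} {β : BraidInf} :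
      ElementaryBraid O O' β → ElementaryBraid (letter c * O) (letter c * O') (shift β)
  | right (c : Color) {O O' : Par} {β : BraidInf} :
      ElementaryBraid O O' β → ElementaryBraid (O * letter c) (O' * letter c) β
  | cable {O O' : Par} {β : BraidInf} (i : ℕ) (hi : i < O.word.length) :
      ElementaryBraid O O' β →
        ElementaryBraid (O.double i) (O'.double (strandPerm β i)) (MixedBraids.cable i β)
  | toStrand {O O' : Par} {β : BraidInf} (i : ℕ) (hi : colorAt O.word i = Color.pole) :
      ElementaryBraid O O' β → ElementaryBraid (O.toStrand i) (O'.toStrand (strandPerm β i)) β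

namespace ElementaryBraid

variable {O O' : Par} {β : BraidInf}

/-- An isomorphism given by a mixed braid and its inverse. -/
noncomputable def isoOfBraid {O O' : Par} (β : BraidInf) (h : IsMixedBraid O.word O'.word β)
    (hs : O.skeleton = O'.skeleton) : O ≅ O' where
  hom := ofBraid β h hs
  inv := ofBraid β⁻¹ h.inv hs.symm
  hom_inv_id := by
    apply PaMBHom.ext
    · show (strandPerm β).trans (strandPerm β⁻¹) = Equiv.refl ℕ
      rw [← strandPerm_mul]; ext; simp [strandPerm]
    · show MonoidAlgebra.single β 1 * MonoidAlgebra.single β⁻¹ 1 = (1 : MonoidAlgebra ℚ BraidInf)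
      simp [MonoidAlgebra.single_mul_single, MonoidAlgebra.one_def]
  inv_hom_id := by
    apply PaMBHom.ext
    · show (strandPerm β⁻¹).trans (strandPerm β) = Equiv.refl ℕ
      rw [← strandPerm_mul]; ext; simp [strandPerm]
    · show MonoidAlgebra.single β⁻¹ 1 * MonoidAlgebra.single β 1 = (1 : MonoidAlgebra ℚ BraidInf)
      simp [MonoidAlgebra.single_mul_single, MonoidAlgebra.one_def]

/-- The inverse of a basic morphism is given by the inverse braid; thus `gen 0` from `sp` to `ps` is
the inverse of the negative crossing. -/
theorem isElementary_inv (h : IsMixedBraid O.word O'.word β) (hs : O.skeleton = O'.skeleton)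
    (hb : IsBasic (ofBraid β h hs)) :
    ∃ h' hs', IsElementary (ofBraid (O := O') (O' := O) β⁻¹ h' hs') :=
  ⟨h.inv, hs.symm, .inverse (isoOfBraid β h hs) hb⟩

theorem isElementary (he : ElementaryBraid O O' β) :
    ∃ h hs, IsElementary (ofBraid (O := O) (O' := O') β h hs) := by
  induction he with
  | cross => exact ⟨_, _, .basic _ .sigmaPos⟩
  | crossInv => exact ⟨_, _, .basic _ .sigmaNeg⟩
  | cross' => simpa using isElementary_inv _ _ .sigmaNeg
  | crossInv' => exact isElementary_inv _ _ .sigmaPos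
  | pps => exact ⟨_, _, .basic _ .alphaPPS⟩
  | psp => exact ⟨_, _, .basic _ .alphaPSP⟩
  | spp => exact ⟨_, _, .basic _ .alphaSPP⟩
  | pps' => simpa using isElementary_inv _ _ .alphaPPS
  | psp' => simpa using isElementary_inv _ _ .alphaPSP
  | spp' => simpa using isElementary_inv _ _ .alphaSPP
  | @left c O O' β _ ih =>
    obtain ⟨h, hs, he⟩ := ih
    have e := he.extendLeft c
    refine ⟨by rw [word_mul, word_mul]; exact h.cons c, by rw [skeleton_mul, skeleton_mul, hs], ?_⟩
    convert e using 1
    apply PaMBHom.ext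
    · exact strandPerm_shift β
    · exact MonoidAlgebra.mapDomain_single.symm
  | @right c O O' β _ ih =>
    obtain ⟨h, hs, he⟩ := ih
    exact ⟨by rw [word_mul, word_mul]; exact h.append c, by rw [skeleton_mul, skeleton_mul, hs],
      he.extendRight c⟩
  | @cable O O' β i hi _ ih =>
    obtain ⟨h, hs, he⟩ := ih
    have e := he.cabling _ i hi
    have h' : IsMixedBraid (O.double i).word (O'.double (strandPerm β i)).word
        (MixedBraids.cable i β) := by
      rw [Par.double, Par.double, word_replace, word_replace]
      exact h.double hi
    have eq : ofBraid _ h' (PaMB.cabling (ofBraid β h hs) i hi).skeleton_eq =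
        PaMB.cabling (ofBraid β h hs) i hi :=
      PaMBHom.ext (strandPerm_cable i β) MonoidAlgebra.mapDomain_single.symm
    exact ⟨h', _, eq ▸ e⟩
  | @toStrand O O' β i hi _ ih =>
    obtain ⟨h, hs, he⟩ := ih
    exact ⟨by
      rw [Par.toStrand, Par.toStrand, word_replace, word_replace]
      exact h.toStrand i, (PaMB.poleToStrand (ofBraid β h hs) i).skeleton_eq,
      he.poleToStrand _ i hi⟩

/-- Each operation commutes with inversion once the affected position is read at the top, as
`strandPerm β i`, instead of at the bottom. -/
theorem symm (he : ElementaryBraid O O' β) : ElementaryBraid O' O β⁻¹ := by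
  induction he with
  | cross => exact crossInv'
  | crossInv => simpa using cross'
  | cross' => exact crossInv
  | crossInv' => simpa using cross
  | pps => simpa using pps'
  | psp => simpa using psp'
  | spp => simpa using spp'
  | pps' => simpa using pps
  | psp' => simpa using psp
  | spp' => simpa using spp
  | left c _ ih => simpa using ih.left c
  | right c _ ih => exact ih.right c
  | @cable O O' β i hi he ih =>
    obtain ⟨h, -, -⟩ := he.isElementary
    have := ih.cable (strandPerm β i) (by rw [h.length_eq]; exact strandPerm_lt h.mem hi)
    have e : strandPerm β⁻¹ (strandPerm β i) = i := by simp [strandPerm]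
    rw [e, cable_inv, e] at this
    exact this
  | @toStrand O O' β i hi he ih =>
    obtain ⟨h, -, -⟩ := he.isElementary
    have := ih.toStrand (strandPerm β i) (by rw [h.color, hi])
    have e : strandPerm β⁻¹ (strandPerm β i) = i := by simp [strandPerm]
    rwa [e] at this

end ElementaryBraid

/-! ### Grafting parenthesized words -/

theorem length_le_length_wordReplace {F : Color → List Color} (hF : ∀ c, 0 < (F c).length)
    (o : List Color) (i : ℕ) : o.length ≤ (wordReplace F o i).length := by
  induction o generalizing i with
  | nil => simp
  | cons c o ih =>
    cases i with
    | zero => have := hF c; simp [wordReplace]; omega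
    | succ i => simpa [wordReplace] using ih i

theorem colorAt_wordReplace_lt {F : Color → List Color} {o : List Color} {i j : ℕ} (h : i < j) :
    colorAt (wordReplace F o j) i = colorAt o i := by
  induction o generalizing i j with
  | nil => rfl
  | cons c o ih =>
    obtain ⟨j, rfl⟩ : ∃ n, j = n + 1 := ⟨j - 1, by omega⟩
    rw [wordReplace, colorAt_cons, colorAt_cons]
    cases i with
    | zero => rfl
    | succ i => exact ih (by omega)

namespace Par

theorem length_treeWord_pos (t : FreeMagma Color) : 0 < (treeWord t).length := by
  induction t using FreeMagma.rec with
  | of c => simp [treeWord]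
  | mul a b iha _ => simp only [treeWord, List.length_append]; omega

/-- A product is grafted by doubling the letter and replacing its two copies. The right copy goes
first, so that the position `i` of the left one is not shifted. -/
theorem treeReplace_double (A B t : FreeMagma Color) {i : ℕ} (hi : i < (treeWord t).length) :
    treeReplace (fun _ => A) (treeReplace (fun _ => B)
        (treeReplace (fun c => .mul (.of c) (.of c)) t i) (i + 1)) i =
      treeReplace (fun _ => .mul A B) t i := by
  induction t using FreeMagma.rec generalizing i with
  | of c =>
    obtain rfl : i = 0 := by simpa [treeWord] using hi
    simp [treeReplace, treeWord]
  | mul a b iha ihb =>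
    rw [treeWord, List.length_append] at hi
    by_cases h : i < (treeWord a).length
    · have h1 : (treeWord (treeReplace (fun c => .mul (.of c) (.of c)) a i)).length =
          (treeWord a).length + 1 := by rw [treeWord_replace]; exact length_wordDouble h
      have h2 := length_le_length_wordReplace (F := fun _ => treeWord B)
        (fun _ => length_treeWord_pos B)
        (treeWord (treeReplace (fun c => .mul (.of c) (.of c)) a i)) (i + 1)
      rw [← treeWord_replace] at h2
      simp only [treeReplace, if_pos h]
      rw [if_pos (by omega), treeReplace, if_pos (by omega), iha h]
    · simp only [treeReplace, if_neg h, if_neg (show ¬ i + 1 < (treeWord a).length by omega)]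
      rw [show i + 1 - (treeWord a).length = i - (treeWord a).length + 1 by omega, ihb (by omega)]

theorem treeReplace_self (c : Color) (t : FreeMagma Color) {i : ℕ} (hi : i < (treeWord t).length)
    (h : colorAt (treeWord t) i = c) : treeReplace (fun _ => .of c) t i = t := by
  induction t using FreeMagma.rec generalizing i with
  | of d =>
    obtain rfl : i = 0 := by simpa [treeWord] using hi
    obtain rfl : d = c := h
    rfl
  | mul a b iha ihb =>
    rw [treeWord] at h hi
    rw [List.length_append] at hi
    rw [treeReplace]
    by_cases ha : i < (treeWord a).length
    · rw [colorAt_append_left ha] at h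
      rw [if_pos ha, iha ha h]
    · rw [colorAt_append_right (not_lt.mp ha)] at h
      rw [if_neg ha, ihb (by omega) h]

/-- Replacing the letter at position `i` by the nonempty parenthesized word `T`. -/
def graft (T : FreeMagma Color) (O : Par) (i : ℕ) : Par := O.replace (fun _ => T) i

theorem word_graft (T : FreeMagma Color) (O : Par) (i : ℕ) :
    (O.graft T i).word = wordReplace (fun _ => treeWord T) O.word i := word_replace _ _ _

theorem graft_mul (A B : FreeMagma Color) (O : Par) {i : ℕ} (hi : i < O.word.length) :
    ((O.double i).graft B (i + 1)).graft A i = O.graft (.mul A B) i := by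
  induction O using WithOne.recOneCoe with
  | one => rfl
  | coe t => exact congrArg _ (treeReplace_double A B t hi)

theorem graft_letter {c : Color} (O : Par) {i : ℕ} (hi : i < O.word.length)
    (h : colorAt O.word i = c) : O.graft (.of c) i = O := by
  induction O using WithOne.recOneCoe with
  | one => rfl
  | coe t => exact congrArg _ (treeReplace_self c t hi h)

theorem eq_one_of_mul_eq_one {O O' : Par} (h : O * O' = 1) : O = 1 ∧ O' = 1 := by
  induction O using WithOne.recOneCoe with
  | one => exact ⟨rfl, by simpa using h⟩
  | coe a =>
    induction O' using WithOne.recOneCoe with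
    | one => exact ⟨h, rfl⟩
    | coe b => exact absurd h (WithOne.coe_ne_one (a := a * b))

end Par

namespace ElementaryBraid

variable {O O' : Par} {β : BraidInf}

/-- Grafting at a strand that is not moved by the braid; `β k` is the braid obtained by doubling this
strand `k` times. -/
theorem graft {T : FreeMagma Color} {i : ℕ} {β : ℕ → BraidInf}
    (hβ : ∀ k j, i ≤ j → j ≤ i + k → MixedBraids.cable j (β k) = β (k + 1) ∧ strandPerm (β k) j = j)
    (he : ElementaryBraid O O' (β 0)) (hi : i < O.word.length)
    (hc : colorAt O.word i = Color.pole ∨ treeSkeleton T = 1) :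
    ElementaryBraid (O.graft T i) (O'.graft T i) (β ((treeWord T).length - 1)) := by
  induction T using FreeMagma.rec generalizing i β O O' with
  | of d =>
    obtain ⟨h, -, -⟩ := he.isElementary
    have hi' : i < O'.word.length := by rwa [h.length_eq]
    have hfix : strandPerm (β 0) i = i := (hβ 0 i le_rfl le_rfl).2
    have hc' : colorAt O'.word i = colorAt O.word i := by rw [← h.color i, hfix]
    -- A leaf needs no doubling, at most a change of color. Only a pole can change: a pole leaf at a
    -- blue position is excluded by `hc`.
    by_cases hd : colorAt O.word i = d
    · rw [graft_letter O hi hd, graft_letter O' hi' (hc'.trans hd)]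
      exact he
    · cases d with
      | pole => exact absurd hc (by simp [hd, treeSkeleton, letter])
      | strand =>
        have hp : colorAt O.word i = Color.pole := by
          cases h : colorAt O.word i with
          | pole => rfl
          | strand => exact absurd h hd
        have := he.toStrand i hp
        rwa [hfix] at this
  | mul A B ihA ihB =>
    -- A product of skeletons is trivial only if both factors are, so the hypothesis passes to `A`
    -- and `B`.
    have hc1 : colorAt O.word i = Color.pole ∨ treeSkeleton A = 1 ∧ treeSkeleton B = 1 :=
      hc.imp_right eq_one_of_mul_eq_one
    have hfix := hβ 0 i le_rfl le_rfl
    have h1 := he.cable i hi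
    rw [hfix.1, hfix.2] at h1
    obtain ⟨h, -, -⟩ := he.isElementary
    have hi' : i < O'.word.length := by rwa [h.length_eq]
    have hw : (O.double i).word = wordReplace (fun c => [c, c]) O.word i := word_replace _ _ _
    have hl : (O.double i).word.length = O.word.length + 1 := by
      rw [hw, length_wordDouble hi]
    have hcol : ∀ x, colorAt (O.double i).word x = cableColors (colorAt O.word) i x := by
      rw [hw, wordDouble hi]; exact fun _ => rfl
    -- One doubling has been used. Grafting `B` uses one doubling less than its number of leaves, so
    -- the graft of `A` starts at the braid with index `(treeWord B).length`.
    have h2 := ihB (β := fun k => β (k + 1)) (i := i + 1)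
      (fun k j h1 h2 => hβ (k + 1) j (by omega) (by omega)) h1 (by omega)
      (by rw [hcol]; simpa [cableColors] using hc1.imp_right And.right)
    have pA := length_treeWord_pos A
    have pB := length_treeWord_pos B
    have e : (treeWord B).length - 1 + 1 = 0 + (treeWord B).length := by omega
    simp only [e] at h2
    have hl2 := length_le_length_wordReplace (F := fun _ => treeWord B) (fun _ => pB)
      (O.double i).word (i + 1)
    rw [← word_graft] at hl2
    have h3 := ihA (β := fun k => β (k + (treeWord B).length)) (i := i)
      (fun k j h1 h2 => by
        have := hβ (k + (treeWord B).length) j h1 (by omega)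
        rwa [show k + 1 + (treeWord B).length = k + (treeWord B).length + 1 by omega]) h2 (by omega)
      (by
        rw [word_graft, colorAt_wordReplace_lt (by omega), hcol]
        simpa [cableColors] using hc1.imp_right And.left)
    rw [graft_mul A B O hi, graft_mul A B O' hi'] at h3
    convert h3 using 2
    rw [treeWord, List.length_append]
    omega

theorem graft_one {T : FreeMagma Color} {i : ℕ} (he : ElementaryBraid O O' 1)
    (hi : i < O.word.length) (hc : colorAt O.word i = Color.pole ∨ treeSkeleton T = 1) :
    ElementaryBraid (O.graft T i) (O'.graft T i) 1 :=
  he.graft (β := fun _ => 1) (fun _ _ _ _ => ⟨cable_one _, by simp [strandPerm]⟩) hi hc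

/-- A straight pole is added on the left and `T` is grafted at it; a pole is chosen because it
accepts every tree. -/
theorem tree_mul (he : ElementaryBraid O O' β) (T : FreeMagma Color) :
    ElementaryBraid (T * O) (T * O') (shift^[(treeWord T).length] β) := by
  have key : ∀ O : Par, (letter Color.pole * O).graft T 0 = T * O := by
    intro O
    induction O using WithOne.recOneCoe with
    | one => rfl
    | coe b => rfl
  have := (he.left Color.pole).graft (T := T) (i := 0) (β := fun k => shift^[k + 1] β)
    (fun k j _ h => ⟨cable_shift_iterate (by omega) β, strandPerm_shift_iterate (by omega) β⟩)
    (by simp [word_mul, word_letter]) (by simp [word_mul, word_letter, colorAt])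
  rw [key, key] at this
  have pT := length_treeWord_pos T
  rwa [show (treeWord T).length - 1 + 1 = (treeWord T).length by omega] at this

/-- As for `tree_mul`; doubling positions to the right of all crossings leaves the braid unchanged.
-/
theorem mul_tree (he : ElementaryBraid O O' β) (T : FreeMagma Color) :
    ElementaryBraid (O * T) (O' * T) β := by
  have key : ∀ O : Par, (O * letter Color.pole).graft T O.word.length = O * T := by
    intro O
    induction O using WithOne.recOneCoe with
    | one => rfl
    | coe a =>
      refine congrArg (WithOne.coe) ?_
      show treeReplace _ _ (treeWord a).length = _
      simp [treeReplace]
  obtain ⟨h, -, -⟩ := he.isElementary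
  have := (he.right Color.pole).graft (T := T) (i := O.word.length) (β := fun _ => β)
    (fun k j hj _ => ⟨cable_of_le h.mem hj, strandPerm_of_le h.mem hj⟩)
    (by simp [word_mul, word_letter])
    (by rw [word_mul, colorAt_append_right le_rfl]; simp [word_letter, colorAt])
  rw [key] at this
  rwa [← h.length_eq, key] at this

/-- The basic associator whose blue letter stands in the place of the tree without poles is used;
the other two places are poles and accept arbitrary trees. -/
theorem assoc_tree (A B C : FreeMagma Color)
    (h : treeSkeleton A = 1 ∨ treeSkeleton B = 1 ∨ treeSkeleton C = 1) :
    ElementaryBraid ((A * B) * C : Par) (A * (B * C)) 1 := by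
  have key : ∀ {a b c : Color}, ElementaryBraid ((letter a * letter b) * letter c)
      (letter a * (letter b * letter c)) 1 → (a = Color.pole ∨ treeSkeleton A = 1) →
      (b = Color.pole ∨ treeSkeleton B = 1) → (c = Color.pole ∨ treeSkeleton C = 1) →
      ElementaryBraid ((A * B) * C : Par) (A * (B * C)) 1 := by
    intro a b c he ha hb hc
    -- Grafting from right to left keeps the remaining positions at 1 and 0.
    have h1 := he.graft_one (i := 2) (T := C) (by simp [word_mul, word_letter]) hc
    have e1 : ((letter a * letter b) * letter c).graft C 2 = (letter a * letter b) * C := rfl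
    have e1' : (letter a * (letter b * letter c)).graft C 2 = letter a * (letter b * C) := rfl
    rw [e1, e1'] at h1
    have h2 := h1.graft_one (i := 1) (T := B) (by simp [word_mul, word_letter]) hb
    have e2 : ((letter a * letter b) * C).graft B 1 = (letter a * B) * C := rfl
    have e2' : (letter a * (letter b * C)).graft B 1 = letter a * (B * C) := rfl
    rw [e2, e2'] at h2
    have h3 := h2.graft_one (i := 0) (T := A) (by simp [word_mul, word_letter]) ha
    have e3 : ((letter a * B) * C).graft A 0 = (A * B) * C := rfl
    have e3' : (letter a * (B * C)).graft A 0 = A * (B * C) := rfl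
    rwa [e3, e3'] at h3
  rcases h with h | h | h
  · exact key spp (.inr h) (.inl rfl) (.inl rfl)
  · exact key psp (.inl rfl) (.inr h) (.inl rfl)
  · exact key pps (.inl rfl) (.inl rfl) (.inr h)

end ElementaryBraid

/-! ### Compositions of elementary braids -/

/-- The pairs of parenthesized words and the braids of compositions of elementary morphisms that are
given by one braid each. -/
inductive BraidProduct : Par → Par → BraidInf → Prop
  | one (O : Par) : BraidProduct O O 1
  | cons {O O' O'' : Par} {β γ : BraidInf} :
      ElementaryBraid O O' β → BraidProduct O' O'' γ → BraidProduct O O'' (β * γ)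

theorem ElementaryBraid.product {O O' : Par} {β : BraidInf} (h : ElementaryBraid O O' β) :
    BraidProduct O O' β := by simpa using BraidProduct.cons h (.one O')

namespace BraidProduct

variable {O O' O'' : Par} {β γ : BraidInf}

theorem mul (h : BraidProduct O O' β) (h' : BraidProduct O' O'' γ) :
    BraidProduct O O'' (β * γ) := by
  induction h with
  | one => simpa using h'
  | cons he _ ih => rw [mul_assoc]; exact .cons he (ih h')

theorem of_one_mul (h : BraidProduct O O' 1) (h' : BraidProduct O' O'' γ) :
    BraidProduct O O'' γ := by simpa using h.mul h'

theorem inv (h : BraidProduct O O' β) : BraidProduct O' O β⁻¹ := by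
  induction h with
  | one => simpa using one _
  | cons he _ ih => rw [mul_inv_rev]; exact ih.mul he.symm.product

theorem symm (h : BraidProduct O O' 1) : BraidProduct O' O 1 := by simpa using h.inv

theorem isProduct (h : BraidProduct O O' β) :
    ∃ h hs, IsProduct (ofBraid (O := O) (O' := O') β h hs) := by
  induction h with
  | one O =>
    have e : ofBraid 1 (.one O.word) rfl = 𝟙 O :=
      PaMBHom.ext (by ext; simp [ofBraid, strandPerm, CategoryStruct.id, MBHom.id]) rfl
    exact ⟨.one _, rfl, e ▸ .id O⟩
  | @cons O O' O'' β γ he _ ih =>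
    obtain ⟨h₁, hs₁, e₁⟩ := he.isElementary
    obtain ⟨h₂, hs₂, e₂⟩ := ih
    have e : ofBraid (β * γ) (h₁.mul h₂) (hs₁.trans hs₂) = ofBraid β h₁ hs₁ ≫ ofBraid γ h₂ hs₂ := by
      apply PaMBHom.ext
      · exact strandPerm_mul β γ
      · show _ = MonoidAlgebra.single β 1 * MonoidAlgebra.single γ 1
        simp [MonoidAlgebra.single_mul_single, ofBraid]
    exact ⟨h₁.mul h₂, hs₁.trans hs₂, e ▸ .comp _ _ e₁ e₂⟩

theorem skeleton_eq (h : BraidProduct O O' β) : O.skeleton = O'.skeleton :=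
  h.isProduct.choose_spec.choose

theorem iterate_shift_gen (n k : ℕ) : shift^[n] (gen k) = gen (n + k) := by
  induction n generalizing k with
  | zero => simp
  | succ n ih => rw [Function.iterate_succ_apply, shift_gen, ih]; congr 1; omega

theorem iterate_shift_gen_inv (n k : ℕ) : shift^[n] (gen k)⁻¹ = (gen (n + k))⁻¹ := by
  have h := iterate_map_mul shift n (gen k) (gen k)⁻¹
  rw [mul_inv_cancel, iterate_map_one, iterate_shift_gen] at h
  exact eq_inv_of_mul_eq_one_right h.symm

theorem mul_left (T : Par) (h : BraidProduct O O' β) :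
    BraidProduct (T * O) (T * O') (shift^[T.word.length] β) := by
  induction T using WithOne.recOneCoe with
  | one => simpa [Par.word] using h
  | coe T =>
    induction h with
    | one => rw [iterate_map_one]; exact one _
    | cons he _ ih => rw [iterate_map_mul]; exact .cons (he.tree_mul T) ih

theorem mul_right (T : Par) (h : BraidProduct O O' β) : BraidProduct (O * T) (O' * T) β := by
  induction T using WithOne.recOneCoe with
  | one => simpa using h
  | coe T =>
    induction h with
    | one => exact one _
    | cons he _ ih => exact .cons (he.mul_tree T) ih

theorem mul_left_one (T : Par) (h : BraidProduct O O' 1) : BraidProduct (T * O) (T * O') 1 := by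
  simpa [iterate_map_one] using h.mul_left T

/-- Extends `assoc_tree` to empty words, where both bracketings coincide. -/
theorem assoc (A B C : Par) (h : A.skeleton = 1 ∨ B.skeleton = 1 ∨ C.skeleton = 1) :
    BraidProduct ((A * B) * C) (A * (B * C)) 1 := by
  induction A using WithOne.recOneCoe with
  | one => simpa using one _
  | coe A =>
    induction B using WithOne.recOneCoe with
    | one => simpa using one _
    | coe B =>
      induction C using WithOne.recOneCoe with
      | one => simpa using one _
      | coe C => exact (ElementaryBraid.assoc_tree A B C h).product

/-! ### Moving a strand through the parentheses -/

theorem skeleton_s : s.skeleton = 1 := rfl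

/-- The strand climbs out of the left factors one after another by `(s A) b ⟶ s (A b)`. -/
theorem exists_strand_mul {w : List Color} (h : O.word = Color.strand :: w) :
    ∃ O', O'.word = w ∧ BraidProduct O (s * O') 1 := by
  induction O using WithOne.recOneCoe with
  | one => cases h
  | coe t =>
    induction t using FreeMagma.rec generalizing w with
    | of c =>
      obtain ⟨rfl, rfl⟩ : c = Color.strand ∧ [] = w := by simpa [Par.word, treeWord] using h
      exact ⟨1, rfl, one _⟩
    | mul a b iha _ =>
      have pa := length_treeWord_pos a
      obtain ⟨c, w1, hw⟩ := List.exists_cons_of_length_pos pa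
      have h' : treeWord a ++ treeWord b = Color.strand :: w := h
      rw [hw, List.cons_append, List.cons.injEq] at h'
      obtain ⟨rfl, rfl⟩ := h'
      obtain ⟨A, hA, hA'⟩ := iha (w := w1) hw
      refine ⟨A * b, by rw [word_mul, hA]; rfl, ?_⟩
      exact (hA'.mul_right b).of_one_mul (assoc s A b (.inl rfl))

theorem exists_mul_strand {w : List Color} (h : O.word = w ++ [Color.strand]) :
    ∃ O', O'.word = w ∧ BraidProduct O (O' * s) 1 := by
  induction O using WithOne.recOneCoe with
  | one => simp [Par.word] at h
  | coe t =>
    induction t using FreeMagma.rec generalizing w with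
    | of c =>
      have h' : [] ++ [c] = w ++ [Color.strand] := h
      obtain ⟨rfl, h'⟩ := List.append_inj' h' rfl
      obtain rfl : c = Color.strand := by simpa using h'
      exact ⟨1, rfl, one _⟩
    | mul a b _ ihb =>
      have pb := length_treeWord_pos b
      obtain ⟨w1, c, hw⟩ : ∃ w1 c, treeWord b = w1 ++ [c] :=
        ⟨_, _, (List.dropLast_append_getLast (List.ne_nil_of_length_pos pb)).symm⟩
      have h' : treeWord a ++ treeWord b = w ++ [Color.strand] := h
      rw [hw, ← List.append_assoc] at h'
      obtain ⟨rfl, h'⟩ := List.append_inj' h' rfl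
      obtain rfl : c = Color.strand := by simpa using h'
      obtain ⟨B, hB, hB'⟩ := ihb (w := w1) hw
      refine ⟨a * B, by rw [word_mul, hB]; rfl, ?_⟩
      exact (hB'.mul_left_one a).of_one_mul (assoc a B s (.inr (.inr rfl))).symm

theorem exists_strands_mul {z w : List Color} (hz : ∀ c ∈ z, c = Color.strand)
    (h : O.word = z ++ w) :
    ∃ Z O', Z.word = z ∧ Z.skeleton = 1 ∧ O'.word = w ∧ BraidProduct O (Z * O') 1 := by
  induction z generalizing O with
  | nil => exact ⟨1, O, rfl, rfl, h, by simpa using one _⟩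
  | cons c z ih =>
    obtain rfl := hz c (by simp)
    obtain ⟨O₁, h₁, e₁⟩ := exists_strand_mul h
    obtain ⟨Z, O₂, hZ, hZ', h₂, e₂⟩ := ih (fun c hc => hz c (by simp [hc])) h₁
    refine ⟨s * Z, O₂, by rw [word_mul, hZ]; rfl, by rw [skeleton_mul, hZ', mul_one]; rfl, h₂, ?_⟩
    exact (e₁.of_one_mul (e₂.mul_left_one s)).of_one_mul (assoc s Z O₂ (.inl rfl)).symm

/-- The basic crossing with its pole changed to a strand. -/
theorem strand_crossing : BraidProduct (s * s) (s * s) (gen 0) := by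
  have h := ElementaryBraid.cross.toStrand 0 rfl
  have e : strandPerm (gen 0) 0 = 1 := by rw [strandPerm_gen]; rfl
  rw [e] at h
  exact h.product

/-- The outer strand descends along the right factors by `(A B) s ⟶ A (B s)` until it stands next to
the single letter `a`, which it crosses with either sign. -/
theorem exists_mul_strand_cross {w : List Color} {a : Color} (h : O.word = w ++ [a]) :
    ∃ O', O'.word = w ++ [Color.strand, a] ∧ BraidProduct (O * s) O' (gen w.length) ∧
      BraidProduct (O * s) O' (gen w.length)⁻¹ := by
  induction O using WithOne.recOneCoe with
  | one => simp [Par.word] at h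
  | coe t =>
    induction t using FreeMagma.rec generalizing w with
    | of c =>
      have h' : [] ++ [c] = w ++ [a] := h
      obtain ⟨rfl, h'⟩ := List.append_inj' h' rfl
      obtain rfl : c = a := by simpa using h'
      cases c with
      | pole => exact ⟨s * p, rfl, ElementaryBraid.cross.product, ElementaryBraid.crossInv.product⟩
      | strand => exact ⟨s * s, rfl, strand_crossing, strand_crossing.inv⟩
    | mul A B _ ihb =>
      have pb := length_treeWord_pos B
      obtain ⟨w1, c, hw⟩ : ∃ w1 c, treeWord B = w1 ++ [c] :=
        ⟨_, _, (List.dropLast_append_getLast (List.ne_nil_of_length_pos pb)).symm⟩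
      have h' : treeWord A ++ treeWord B = w ++ [a] := h
      rw [hw, ← List.append_assoc] at h'
      obtain ⟨rfl, h'⟩ := List.append_inj' h' rfl
      obtain rfl : c = a := by simpa using h'
      obtain ⟨B', hB, c₁, c₂⟩ := ihb (w := w1) hw
      have al := assoc A B s (.inr (.inr rfl))
      have d₁ := al.of_one_mul (c₁.mul_left A)
      have d₂ := al.of_one_mul (c₂.mul_left A)
      rw [iterate_shift_gen] at d₁
      rw [iterate_shift_gen_inv] at d₂
      rw [List.length_append]
      exact ⟨A * B', by rw [word_mul, hB, List.append_assoc]; rfl, d₁, d₂⟩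

theorem exists_strand_mul_cross {w : List Color} {a : Color} (h : O.word = a :: w) :
    ∃ O', O'.word = a :: Color.strand :: w ∧ BraidProduct (s * O) O' (gen 0) ∧
      BraidProduct (s * O) O' (gen 0)⁻¹ := by
  induction O using WithOne.recOneCoe with
  | one => cases h
  | coe t =>
    induction t using FreeMagma.rec generalizing w with
    | of c =>
      obtain ⟨rfl, rfl⟩ : c = a ∧ [] = w := by simpa [Par.word, treeWord] using h
      cases c with
      | pole =>
        exact ⟨p * s, rfl, ElementaryBraid.cross'.product, ElementaryBraid.crossInv'.product⟩
      | strand => exact ⟨s * s, rfl, strand_crossing, strand_crossing.inv⟩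
    | mul A B iha _ =>
      have pa := length_treeWord_pos A
      obtain ⟨c, w1, hw⟩ := List.exists_cons_of_length_pos pa
      have h' : treeWord A ++ treeWord B = a :: w := h
      rw [hw, List.cons_append, List.cons.injEq] at h'
      obtain ⟨rfl, rfl⟩ := h'
      obtain ⟨A', hA, c₁, c₂⟩ := iha (w := w1) hw
      have al := (assoc s A B (.inl rfl)).symm
      exact ⟨A' * B, by rw [word_mul, hA]; rfl, al.of_one_mul (c₁.mul_right B),
        al.of_one_mul (c₂.mul_right B)⟩

end BraidProduct

/-! ### Lifting a local crossing to parenthesized words -/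

theorem Swap.exists_append {o o' : List Color} {k : ℕ} (h : Swap o o' k) :
    ∃ u a b v, o = u ++ a :: b :: v ∧ o' = u ++ b :: a :: v ∧ k = u.length ∧
      ¬ (a = Color.pole ∧ b = Color.pole) := by
  induction h with
  | head v h => exact ⟨[], _, _, v, rfl, rfl, rfl, h⟩
  | cons c _ ih =>
    obtain ⟨u, a, b, v, rfl, rfl, rfl, h⟩ := ih
    exact ⟨c :: u, a, b, v, rfl, rfl, rfl, h⟩

/-- If both letters lie in one factor of `A * B`, induction applies. Otherwise one of them is a
strand at the boundary; it is pulled out of its factor, reassociated to the other factor and crossed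
there. One target serves both signs. -/
theorem Swap.exists_braidProduct {O : Par} {o' : List Color} {k : ℕ} (h : Swap O.word o' k) :
    ∃ O', O'.word = o' ∧ BraidProduct O O' (gen k) ∧ BraidProduct O O' (gen k)⁻¹ := by
  induction O using WithOne.recOneCoe with
  | one => cases h
  | coe t =>
    induction t using FreeMagma.rec generalizing o' k with
    | of c => cases h with | cons _ h => cases h
    | mul A B iha ihb =>
      obtain ⟨u, a, b, v, hw, rfl, rfl, hab⟩ := h.exists_append
      have hw' : treeWord A ++ treeWord B = u ++ a :: b :: v := hw
      have right : ∀ t, u = treeWord A ++ t → treeWord B = t ++ a :: b :: v →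
          ∃ O' : Par, O'.word = u ++ b :: a :: v ∧
            BraidProduct (A * B) O' (gen u.length) ∧ BraidProduct (A * B) O' (gen u.length)⁻¹ := by
        rintro t rfl ht
        obtain ⟨B', hB, c₁, c₂⟩ := ihb (o' := t ++ b :: a :: v) (k := t.length) (by
          show Swap (treeWord B) _ _
          rw [ht]
          exact .of_append t v hab)
        have d₁ := c₁.mul_left A
        have d₂ := c₂.mul_left A
        rw [BraidProduct.iterate_shift_gen] at d₁
        rw [BraidProduct.iterate_shift_gen_inv] at d₂
        rw [List.length_append]
        exact ⟨A * B', by rw [word_mul, hB, List.append_assoc]; rfl, d₁, d₂⟩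
      rcases List.append_eq_append_iff.mp hw' with ⟨t, hu, ht⟩ | ⟨t, hu, ht⟩
      · exact right t hu ht
      -- `t` is the part of the pair and its continuation that lies in `A`: with no letter the pair
      -- is in `B`, with one letter it straddles the boundary, with at least two it is in `A`.
      · rcases t with _ | ⟨c, _ | ⟨d, t⟩⟩
        · exact right [] (by simpa using hu.symm) (by simpa using ht.symm)
        · obtain ⟨rfl, hB⟩ : a = c ∧ b :: v = treeWord B := by simpa using ht
          cases b with
          | strand =>
            obtain ⟨B', hB', eB⟩ := BraidProduct.exists_strand_mul (O := B) hB.symm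
            obtain ⟨A', hA, c₁, c₂⟩ := BraidProduct.exists_mul_strand_cross (O := A) hu
            have al := (eB.mul_left_one A).of_one_mul (BraidProduct.assoc A s B' (.inr (.inl rfl))).symm
            exact ⟨A' * B', by simp [word_mul, hA, hB'], al.of_one_mul (c₁.mul_right B'),
              al.of_one_mul (c₂.mul_right B')⟩
          | pole =>
            cases a with
            | pole => simp at hab
            | strand =>
              obtain ⟨A', hA, eA⟩ := BraidProduct.exists_mul_strand (O := A) hu
              obtain ⟨B', hB', c₁, c₂⟩ := BraidProduct.exists_strand_mul_cross (O := B) hB.symm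
              have al := (eA.mul_right B).of_one_mul (BraidProduct.assoc A' s B (.inr (.inl rfl)))
              have d₁ := c₁.mul_left A'
              have d₂ := c₂.mul_left A'
              rw [BraidProduct.iterate_shift_gen, hA] at d₁
              rw [BraidProduct.iterate_shift_gen_inv, hA] at d₂
              exact ⟨A' * B', by simp [word_mul, hA, hB'], al.of_one_mul d₁, al.of_one_mul d₂⟩
        · obtain ⟨rfl, rfl, rfl⟩ : a = c ∧ b = d ∧ v = t ++ treeWord B := by simpa using ht
          obtain ⟨A', hA, c₁, c₂⟩ := iha (o' := u ++ b :: a :: t) (k := u.length) (by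
            show Swap (treeWord A) _ _
            rw [hu]
            exact .of_append u t hab)
          exact ⟨A' * B, by rw [word_mul, hA]; simp [Par.word], c₁.mul_right B, c₂.mul_right B⟩

/-! ### Parenthesizations with the same word and skeleton -/

theorem numPoles_eq_zero_iff {z : List Color} :
    numPoles z = 0 ↔ ∀ c ∈ z, c = Color.strand := by
  induction z with
  | nil => simp [numPoles, polesBelow]
  | cons c z ih =>
    have h := numPoles_append [c] z
    rw [List.singleton_append] at h
    rw [h, List.forall_mem_cons, ← ih, Nat.add_eq_zero_iff]
    cases c with
    | pole => simp [show numPoles [Color.pole] = 1 from rfl]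
    | strand => simp [show numPoles [Color.strand] = 0 from rfl]

theorem numPoles_skeleton (O : Par) : numPoles O.skeleton.word = numPoles O.word := by
  induction O using WithOne.recOneCoe with
  | one => rfl
  | coe t => exact numPoles_treeSkeleton t

theorem skeleton_ne_one {O : Par} (h : Color.pole ∈ O.word) : O.skeleton ≠ 1 := by
  intro h1
  have e := numPoles_skeleton O
  rw [h1] at e
  cases numPoles_eq_zero_iff.mp e.symm _ h

/-- Factorization in a free magma is unique; the adjoined unit spoils this only through trivial
factors. -/
theorem mul_inj_of_ne_one {P Q P' Q' : Par} (hP : P ≠ 1) (hQ : Q ≠ 1) (hP' : P' ≠ 1)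
    (hQ' : Q' ≠ 1) (h : P * Q = P' * Q') : P = P' ∧ Q = Q' := by
  obtain ⟨a, rfl⟩ := WithOne.ne_one_iff_exists.mp hP
  obtain ⟨b, rfl⟩ := WithOne.ne_one_iff_exists.mp hQ
  obtain ⟨a', rfl⟩ := WithOne.ne_one_iff_exists.mp hP'
  obtain ⟨b', rfl⟩ := WithOne.ne_one_iff_exists.mp hQ'
  have h' : FreeMagma.mul a b = FreeMagma.mul a' b' := WithOne.coe_injective h
  injection h' with h₁ h₂
  rw [h₁, h₂]
  exact ⟨rfl, rfl⟩

/-- Two parenthesizations of a word with the same skeleton are connected by a product of elementary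
morphisms with trivial braid. -/
theorem braidProduct_one_of_word_eq {O O' : Par} (hw : O.word = O'.word)
    (hs : O.skeleton = O'.skeleton) : BraidProduct O O' 1 := by
  induction hn : O.word.length using Nat.strong_induction_on generalizing O O' with
  | _ n ih =>
  subst hn
  -- The two trees split the same word at places that differ by `z`. Equal skeletons of `A` and `A'`
  -- force `z` to contain only strands, so `z` moves across: `A B ⟶ A (Z B₁) ⟶ (A Z) B₁ ⟶ A' B₁ ⟶ A'
  -- B'`.
  have rebracket : ∀ {A B A' B' : Par} (z : List Color), A.word ++ B.word = O.word →
      0 < A.word.length → 0 < B'.word.length → A.skeleton = A'.skeleton →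
      B.skeleton = B'.skeleton → A'.word = A.word ++ z → B.word = z ++ B'.word →
      BraidProduct (A * B) (A' * B') 1 := by
    intro A B A' B' z hO hA hB' hsA hsB hzA hzB
    have hz : numPoles z = 0 := by
      have h1 := numPoles_skeleton A
      rw [hsA, numPoles_skeleton, hzA, numPoles_append] at h1
      omega
    obtain ⟨Z, B₁, hZ, hZ', hB₁, e⟩ :=
      BraidProduct.exists_strands_mul (numPoles_eq_zero_iff.mp hz) hzB
    have hl := congrArg List.length hO
    rw [hzB] at hl
    simp only [List.length_append] at hl
    have e₁ := (e.mul_left_one A).of_one_mul (BraidProduct.assoc A Z B₁ (.inr (.inl hZ'))).symm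
    -- Induction applies because `A * Z` lacks the letters of the nonempty `B'`, and below `B₁`
    -- lacks those of the nonempty `A`.
    have e₂ : BraidProduct (A * Z) A' 1 := ih _ (by rw [word_mul, hZ, List.length_append]; omega)
      (by rw [word_mul, hZ, hzA]) (by rw [skeleton_mul, hZ', mul_one, hsA]) rfl
    have e₃ : BraidProduct B₁ B' 1 := ih _ (by rw [hB₁]; omega) hB₁ (by
      have := e.skeleton_eq
      rw [skeleton_mul, hZ', one_mul] at this
      rw [← this, hsB]) rfl
    exact (e₁.of_one_mul (e₂.mul_right B₁)).of_one_mul (e₃.mul_left_one A')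
  -- A strand at an end of the word is pulled out of both trees, which leaves shorter words with the
  -- same skeletons.
  have first : ∀ w, O.word = Color.strand :: w → BraidProduct O O' 1 := by
    intro w h
    obtain ⟨O₁, h₁, e₁⟩ := BraidProduct.exists_strand_mul h
    obtain ⟨O₂, h₂, e₂⟩ := BraidProduct.exists_strand_mul (hw ▸ h)
    have hs' : O₁.skeleton = O₂.skeleton := by
      have h3 := e₁.skeleton_eq
      have h4 := e₂.skeleton_eq
      rw [skeleton_mul, BraidProduct.skeleton_s, one_mul] at h3 h4
      rw [← h3, hs, h4]
    have e := ih O₁.word.length (by rw [h, h₁]; simp) (h₁.trans h₂.symm) hs' rfl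
    exact (e₁.of_one_mul (e.mul_left_one s)).of_one_mul e₂.symm
  have last : ∀ w, O.word = w ++ [Color.strand] → BraidProduct O O' 1 := by
    intro w h
    obtain ⟨O₁, h₁, e₁⟩ := BraidProduct.exists_mul_strand h
    obtain ⟨O₂, h₂, e₂⟩ := BraidProduct.exists_mul_strand (hw ▸ h)
    have hs' : O₁.skeleton = O₂.skeleton := by
      have h3 := e₁.skeleton_eq
      have h4 := e₂.skeleton_eq
      rw [skeleton_mul, BraidProduct.skeleton_s, mul_one] at h3 h4
      rw [← h3, hs, h4]
    have e := ih O₁.word.length (by rw [h, h₁]; simp) (h₁.trans h₂.symm) hs' rfl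
    exact (e₁.of_one_mul (e.mul_right s)).of_one_mul e₂.symm
  induction O using WithOne.recOneCoe with
  | one =>
    induction O' using WithOne.recOneCoe with
    | one => exact .one _
    | coe t =>
      have := length_treeWord_pos t
      have h : [] = treeWord t := hw
      simp [← h] at this
  | coe t =>
    induction O' using WithOne.recOneCoe with
    | one =>
      have := length_treeWord_pos t
      have h : treeWord t = [] := hw
      simp [h] at this
    | coe t' =>
      have hw' : treeWord t = treeWord t' := hw
      have hl := congrArg List.length hw'
      rcases t with c | ⟨A, B⟩
      · rcases t' with c' | ⟨A', B'⟩
        · obtain rfl : c = c' := by simpa [treeWord] using hw'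
          exact .one _
        · have := length_treeWord_pos A'
          have := length_treeWord_pos B'
          simp only [treeWord, List.length_append, List.length_singleton] at hl
          omega
      · have pA := length_treeWord_pos A
        have pB := length_treeWord_pos B
        rcases t' with c' | ⟨A', B'⟩
        · simp only [treeWord, List.length_append, List.length_singleton] at hl
          omega
        · have pA' := length_treeWord_pos A'
          have pB' := length_treeWord_pos B'
          rw [treeWord, treeWord] at hw'
          obtain ⟨c, w, hA⟩ := List.exists_cons_of_length_pos pA
          obtain ⟨c', w', hA'⟩ := List.exists_cons_of_length_pos pA'
          obtain ⟨x, d, hB⟩ : ∃ x d, treeWord B = x ++ [d] :=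
            ⟨_, _, (List.dropLast_append_getLast (List.ne_nil_of_length_pos pB)).symm⟩
          obtain ⟨x', d', hB'⟩ : ∃ x d, treeWord B' = x ++ [d] :=
            ⟨_, _, (List.dropLast_append_getLast (List.ne_nil_of_length_pos pB')).symm⟩
          cases c with
          | strand =>
            exact first (w ++ treeWord B) (by
              show treeWord A ++ treeWord B = _
              rw [hA]; rfl)
          | pole =>
            cases d with
            | strand =>
              exact last (treeWord A ++ x) (by
                show treeWord A ++ treeWord B = _
                rw [hB, List.append_assoc])
            | pole =>
              -- Now the word begins and ends with a pole. Hence all four factors contain poles,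
              -- their skeletons are nontrivial, and the common skeleton splits in the same way for
              -- both trees.
              have hc := hw'
              rw [hA, hA', List.cons_append, List.cons_append, List.cons.injEq] at hc
              obtain ⟨rfl, -⟩ := hc
              have hd := hw'
              rw [hB, hB', ← List.append_assoc, ← List.append_assoc] at hd
              obtain ⟨-, hd⟩ := List.append_inj' hd rfl
              obtain rfl : Color.pole = d' := by simpa using hd
              obtain ⟨hsA, hsB⟩ := mul_inj_of_ne_one
                (P := Par.skeleton A) (Q := Par.skeleton B)
                (P' := Par.skeleton A') (Q' := Par.skeleton B')
                (skeleton_ne_one (O := A) (by show _ ∈ treeWord A; simp [hA]))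
                (skeleton_ne_one (O := B) (by show _ ∈ treeWord B; simp [hB]))
                (skeleton_ne_one (O := A') (by show _ ∈ treeWord A'; simp [hA']))
                (skeleton_ne_one (O := B') (by show _ ∈ treeWord B'; simp [hB'])) hs
              -- `rebracket` assumes that the first tree splits further left; the other case is its
              -- inverse.
              rcases List.append_eq_append_iff.mp hw' with ⟨z, hz1, hz2⟩ | ⟨z, hz1, hz2⟩
              · exact rebracket (A := A) (B := B) (A' := A') (B' := B') z rfl pA pB' hsA hsB hz1 hz2
              · exact (rebracket (A := A') (B := B') (A' := A) (B' := B) z hw'.symm pA' pB hsA.symm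
                  hsB.symm hz1 hz2).symm

/-! ### From local braids to the theorem -/

theorem LocalBraid.braidProduct {o o' : List Color} {β : BraidInf} (h : LocalBraid o o' β)
    {O O' : Par} (hO : O.word = o) (hO' : O'.word = o') (hs : O.skeleton = O'.skeleton) :
    BraidProduct O O' β := by
  induction h generalizing O with
  | one => exact braidProduct_one_of_word_eq (hO.trans hO'.symm) hs
  | gen_mul h _ ih =>
    subst hO
    obtain ⟨O₁, h₁, e, -⟩ := h.exists_braidProduct
    exact e.mul (ih h₁ hO' (e.skeleton_eq.symm.trans hs))
  | inv_mul h _ ih =>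
    subst hO
    obtain ⟨O₁, h₁, -, e⟩ := h.exists_braidProduct
    exact e.mul (ih h₁ hO' (e.skeleton_eq.symm.trans hs))

/-- The crossings are lifted one by one, each dictating the next parenthesization. Skeletons never
change, so the last one can be corrected to `O'` with trivial braid. -/
theorem IsMixedBraid.isProduct_ofBraid {O O' : Par} {β : BraidInf}
    (h : IsMixedBraid O.word O'.word β) (hs : O.skeleton = O'.skeleton) :
    IsProduct (ofBraid β h hs) :=
  (h.localBraid.braidProduct rfl rfl hs).isProduct.choose_spec.choose_spec

end MixedBraids

theorem proposition4p1 :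
    (∀ (O O' : MixedBraids.Par) (β : MixedBraids.BraidInf)
      (h : MixedBraids.IsMixedBraid O.word O'.word β) (hs : O.skeleton = O'.skeleton),
      MixedBraids.PaMB.IsProduct (MixedBraids.PaMB.ofBraid β h hs)) ∧
    ∀ (O O' : MixedBraids.Par) (f : O ⟶ O'), MixedBraids.PaMB.IsGenerated f := by
  refine ⟨fun O O' β h hs => h.isProduct_ofBraid hs, fun O O' f => ?_⟩
  show f.comb ∈ _
  -- Every braid in the support is a mixed braid with permutation `f.perm`, so each term is a
  -- multiple of a composition covered by the first part.
  rw [← MonoidAlgebra.sum_coeff_single f.comb]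
  refine Submodule.sum_mem _ fun β hβ => ?_
  obtain ⟨h, hp⟩ := f.isMixedBraid β hβ
  rw [← mul_one (f.comb.coeff β), ← smul_eq_mul, ← MonoidAlgebra.smul_single]
  exact Submodule.smul_mem _ _ (Submodule.subset_span
    ⟨_, h.isProduct_ofBraid f.skeleton_eq, hp, rfl⟩)
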